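/- Let $\mathcal V,\mathcal X,\mathcal Y$ be finite alphabets, $P_V$ a distribution on $\mathcal V$ and $W(y|x)$ a channel from $\mathcal X$ to $\mathcal Y$. Source and channel are memoryless: $P^k(\boldsymbol v)=\prod_i P_V(v_i)$, $W^n(\boldsymbol y|\boldsymbol x)=\prod_i W(y_i|x_i)$. For each blocklength $n\ge 1$ let $k=k_n\ge1$ be the source length and $t=k/n$, with $t$ bounded in $n$. Logarithms are natural. Write $\mathcal T^n(Q)$ for the set of sequences of length $n$ with type (empirical distribution) $Q$. Let $P_1,\dots,P_{N_k}$ be the types of sequences in $\mathcal V^k$, and put $R_i=tH(P_i)$. Let $Q_1,\dots,Q_m$ be types of sequences in $\mathcal X^n$ (they may depend on $n$; $m$ is fixed), $\mathcal Q_m=\{Q_1,\dots,Q_m\}$, and let $\mu(i)\in\{1,\dots,m\}$ be arbitrary. Put $\zeta_n=N_k(n+1)^{|\mathcal X|^2+|\mathcal X|}$. For nonnegative sequences, $f_n\,\dot\le\,g_n$ means that for every $\varepsilon>0$, $f_n\le e^{n\varepsilon}g_n$ for all large $n$. *Exponents.* Let $$e(R,P_V)=\min_{Q:H(Q)\ge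 R}D(Q\|P_V),\qquad E_{\rm r}(Q,R)=\min_{P_{XY}:P_X=Q}D(P\|Q\times W)+|I_P(X;Y)-R|^+,$$ $$E'_{\rm ex}(Q,\mathcal Q,R)=\min_{\Lambda_{X\bar X}:\ \Lambda_X=Q,\ \Lambda_{\bar X}\in\mathcal Q,\ I(\Lambda)\le R}\mathbb E_\Lambda[d_W(X,\bar X)]+I(\Lambda)-R,\qquad d_W(x,\bar x)=-\log\sum_y\sqrt{W(y|x)W(y|\bar x)},$$ with values in $(-\infty,\infty]$. *Ensemble.* Let $d(P)=-I(P)$ and $\Delta_i=-(R_i+\delta)$, where $\delta=\delta_n>0$ satisfies $\zeta_ne^{-n\delta_n}\to0$ (for instance, a constant $\delta$ or $\delta_n=n^{-1/2}$). The messages $\boldsymbol v\in\mathcal V^k$ are listed so that the rates $R_i$ of their types are non-decreasing (ties in any order), and their codewords are drawn one after the other: the codeword of a message of type $P_i$ is drawn equiprobably from the set of all $\bar{\boldsymbol x}\in\mathcal T^n(Q_{\mu(i)})$ with $d(\hat P_{\boldsymbol x\bar{\boldsymbol x}})>\max(\Delta_i,\Delta_j)$ for every earlier codeword $\boldsymbol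 x$, where $P_j$ is the type of the message of $\boldsymbol x$. A decoder with metric $q$ outputs a message maximizing $q(i,\hat P_{\boldsymbol x_{\boldsymbol v}\boldsymbol y})$, where $P_i$ is the type of $\boldsymbol v$, with ties broken arbitrarily; $\bar p_e$ is the error probability averaged over the ensemble. Then the following hold. 1. For every $n\ge1$, every $c$ and all $\tilde{\boldsymbol x}_j\in\mathcal T^n(Q_{\mu(j)})$, $$\sum_{j=1}^{N_k}\ \sum_{\bar{\boldsymbol x}\in\mathcal T^n(Q_c):\,d(\hat P_{\bar{\boldsymbol x}\tilde{\boldsymbol x}_j})\le\Delta_j}|\mathcal T^k(P_j)|\le\zeta_n|\mathcal T^n(Q_c)|e^{-n\delta},$$ and for all large $n$ the construction almost surely produces all $|\mathcal V|^k$ codewords. 2. With the metric $q(i,P)=I(P)-R_i$, $$\bar p_e\,\dot\le\,\sum_{i=1}^{N_k}\exp\Big(-n\Big[te\Big(\frac{R_i}t,P_V\Big)+E_{\rm r}(Q_{\mu(i)},R_i)\Big]\Big).$$ 3. With the metric $q(i,P)=\mathbb E_P[\log W(Y|X)]-2R_i$, $$\bar p_e\,\dot\le\,\sum_{i=1}^{N_k}\exp\Big(-n\Big[te\Big(\frac{R_i}t,P_V\Big)+E'_{\rm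 ex}(Q_{\mu(i)},\mathcal Q_m,R_i+\delta_n)+\delta_n\Big]\Big),$$ and $E'_{\rm ex}(Q_c,\mathcal Q_m,R+s)\to E'_{\rm ex}(Q_c,\mathcal Q_m,R)$ as $s\downarrow0$, for all $n$, $c$ and $R\in\mathbb R$. 4. Suppose in addition that $\delta_n\to0$ and that $d_W(x,\bar x)<\infty$ whenever $Q_c(x)>0$ and $Q_{c'}(\bar x)>0$ for some $c,c'$ at the same blocklength. Then with the metric of part 3 $$\bar p_e\,\dot\le\,\sum_{i=1}^{N_k}\exp\Big(-n\Big[te\Big(\frac{R_i}t,P_V\Big)+E'_{\rm ex}(Q_{\mu(i)},\mathcal Q_m,R_i)\Big]\Big).$$ Hence the same ensemble attains the maximum of the two exponents: with $$E_n=\max\Big\{\min_i\Big[te\Big(\frac{R_i}t,P_V\Big)+E_{\rm r}(Q_{\mu(i)},R_i)\Big],\ \min_i\Big[te\Big(\frac{R_i}t,P_V\Big)+E'_{\rm ex}(Q_{\mu(i)},\mathcal Q_m,R_i)\Big]\Big\},$$ the smaller of the average error probabilities under the two metrics is $\dot\le\,e^{-nE_n}$, and there are codebooks $\mathcal C_n$,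 of positive probability in the ensemble for all large $n$, and decoders for which the error probability is $\dot\le\,e^{-nE_n}$. -/

import Mathlib

open scoped ENNReal Topology

namespace RGV

/-! ### Types (empirical distributions) and type classes -/

section Types

variable {α : Type*}

open Classical in
/-- The type (empirical distribution) of a sequence. -/
noncomputable def empType {n : ℕ} (x : Fin n → α) : α → ℝ :=
  fun a => ((Finset.univ.filter fun i => x i = a).card : ℝ) / n

/-- The joint type of a pair of sequences. -/
noncomputable def jointType {β : Type*} {n : ℕ} (x : Fin n → α) (y : Fin n → β) : α × β → ℝ :=
  empType fun i => (x i, y i)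

open Classical in
/-- The set of all types of sequences of length `n`. -/
noncomputable def types (α : Type*) [Fintype α] (n : ℕ) : Finset (α → ℝ) :=
  Finset.univ.image fun x : Fin n → α => empType x

open Classical in
/-- The type class of `Q`: all sequences of length `n` that have type `Q`. -/
noncomputable def typeClass [Fintype α] (n : ℕ) (Q : α → ℝ) : Finset (Fin n → α) :=
  Finset.univ.filter fun x => empType x = Q

end Types

/-! ### Information quantities on finite alphabets (natural logarithms) -/

section Information

variable {α β : Type*} [Fintype α] [Fintype β]

/-- Shannon entropy. -/
noncomputable def entropy (P : α → ℝ) : ℝ := ∑ a, Real.negMulLog (P a)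

/-- First marginal. -/
def marg₁ (P : α × β → ℝ) : α → ℝ := fun a => ∑ b, P (a, b)

/-- Second marginal. -/
def marg₂ (P : α × β → ℝ) : β → ℝ := fun b => ∑ a, P (a, b)

/-- Mutual information of a joint distribution. -/
noncomputable def mutualInfo (P : α × β → ℝ) : ℝ :=
  entropy (marg₁ P) + entropy (marg₂ P) - entropy P

open Classical in
/-- Relative entropy `D(P ‖ Q)`, equal to `∞` when `P` is not absolutely continuous w.r.t. `Q`. -/
noncomputable def relEntropy (P Q : α → ℝ) : EReal :=
  if ∀ a, Q a = 0 → P a = 0 then ((∑ a, P a * Real.log (P a / Q a) : ℝ) : EReal) else ⊤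

end Information

/-! ### Exponents -/

section Exponents

variable {V X Y : Type*} [Fintype V] [Fintype X] [Fintype Y]

/-- Source reliability function `e(R, P_V) = min_{Q : H(Q) ≥ R} D(Q ‖ P_V)`. -/
noncomputable def sourceExponent (R : ℝ) (PV : V → ℝ) : EReal :=
  ⨅ Q ∈ {Q : V → ℝ | Q ∈ stdSimplex ℝ V ∧ R ≤ entropy Q}, relEntropy Q PV

/-- Random-coding exponent
`E_r(Q, R) = min_{P : P_X = Q} D(P ‖ Q × W) + |I_P(X;Y) - R|⁺`. -/
noncomputable def randomCodingExponent (W : X → Y → ℝ) (Q : X → ℝ) (R : ℝ) : EReal :=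
  ⨅ P ∈ {P : X × Y → ℝ | P ∈ stdSimplex ℝ (X × Y) ∧ marg₁ P = Q},
    relEntropy P (fun z => Q z.1 * W z.1 z.2) + ((max (mutualInfo P - R) 0 : ℝ) : EReal)

/-- Bhattacharyya coefficient `∑_y √(W(y|x) W(y|x̄))`. -/
noncomputable def bhattCoeff (W : X → Y → ℝ) (x x' : X) : ℝ := ∑ y, √(W x y * W x' y)

open Classical in
/-- `E_Λ[d_W(X, X̄)]` with `d_W(x, x̄) = -log ∑_y √(W(y|x) W(y|x̄))`; it is `∞` when `Λ` charges a
pair at infinite Bhattacharyya distance. -/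
noncomputable def meanBhattDist (W : X → Y → ℝ) (L : X × X → ℝ) : EReal :=
  if ∀ z, bhattCoeff W z.1 z.2 = 0 → L z = 0 then
    ((∑ z, L z * -Real.log (bhattCoeff W z.1 z.2) : ℝ) : EReal)
  else ⊤

/-- Expurgated exponent
`E'_ex(Q, 𝒬, R) = min_{Λ : Λ_X = Q, Λ_X̄ ∈ 𝒬, I(Λ) ≤ R} E_Λ[d_W(X, X̄)] + I(Λ) - R`. -/
noncomputable def expurgatedExponent (W : X → Y → ℝ) (Q : X → ℝ) (𝒬 : Set (X → ℝ)) (R : ℝ) :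
    EReal :=
  ⨅ L ∈ {L : X × X → ℝ | L ∈ stdSimplex ℝ (X × X) ∧ marg₁ L = Q ∧ marg₂ L ∈ 𝒬 ∧
      mutualInfo L ≤ R},
    meanBhattDist W L + ((mutualInfo L - R : ℝ) : EReal)

/-- The rate `R_i = t H(P_i)` of the source type `P_i`, where `t = k / n`. -/
noncomputable def rate (k n : ℕ) (P : V → ℝ) : ℝ := ((k : ℝ) / n) * entropy P

/-- `t e(R_i / t, P_V) + E_r(Q_{μ(i)}, R_i)` for the source type `P = P_i`, where `t = k / n`. -/
noncomputable def jsccRandomCoding (W : X → Y → ℝ) (PV : V → ℝ) {m : ℕ} (k n : ℕ)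
    (Q : Fin m → X → ℝ) (μ : (V → ℝ) → Fin m) (P : V → ℝ) : EReal :=
  (((k : ℝ) / n : ℝ) : EReal) * sourceExponent (rate k n P / ((k : ℝ) / n)) PV
    + randomCodingExponent W (Q (μ P)) (rate k n P)

/-- `t e(R_i / t, P_V) + min {E_Λ[d_W(X, X̄)] + I(Λ) - R_i}` for the source type `P = P_i`, where
`t = k / n` and the minimum is over all `Λ` with `Λ_X = Q_{μ(i)}`, `Λ_X̄ ∈ {Q_1, …, Q_m}` and
`I(Λ) ≤ R_i + s`. The minimum is `E'_ex(Q_{μ(i)}, 𝒬_m, R_i + s) + s`; with `s = 0` it is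
`E'_ex(Q_{μ(i)}, 𝒬_m, R_i)`. -/
noncomputable def jsccExpurgated (W : X → Y → ℝ) (PV : V → ℝ) {m : ℕ} (k n : ℕ)
    (Q : Fin m → X → ℝ) (μ : (V → ℝ) → Fin m) (s : ℝ) (P : V → ℝ) : EReal :=
  (((k : ℝ) / n : ℝ) : EReal) * sourceExponent (rate k n P / ((k : ℝ) / n)) PV
    + (expurgatedExponent W (Q (μ P)) (Set.range Q) (rate k n P + s) + (s : EReal))

/-- `exp(-n E)` for an extended real `E`; `exp(-n ∞) = 0` for `n ≥ 1`. -/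
noncomputable def expNeg (n : ℕ) (E : EReal) : ℝ≥0∞ := EReal.exp (((-(n : ℝ) : ℝ) : EReal) * E)

/-- Inequality up to subexponential factors, `f_n ≤̇ g_n`. For positive finite sequences this is
`limsup (1/n) log (f_n / g_n) ≤ 0`. -/
def DotLE (f g : ℕ → ℝ≥0∞) : Prop :=
  ∀ ε : ℝ, 0 < ε → ∀ᶠ n : ℕ in Filter.atTop, f n ≤ ENNReal.ofReal (Real.exp (n * ε)) * g n

end Exponents

/-! ### Codes, decoders and error probability -/

section Codes

variable {V X Y : Type*} [Fintype V] [Fintype X] [Fintype Y]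

/-- A codebook: every source message of length `k` is assigned a codeword of length `n`. -/
abbrev Codebook (V X : Type*) (k n : ℕ) := (Fin k → V) → (Fin n → X)

open Classical in
/-- Error probability of the code with encoder `C` and decoder `φ`, for the memoryless source `PV`
and the memoryless channel `W`. -/
noncomputable def errorProb (PV : V → ℝ) (W : X → Y → ℝ) {k n : ℕ} (C : Codebook V X k n)
    (φ : (Fin n → Y) → (Fin k → V)) : ℝ :=
  ∑ v : Fin k → V, (∏ i, PV (v i)) *
    ∑ y : Fin n → Y, if φ y = v then 0 else ∏ i, W (C v i) (y i)

/-- `φ` is a decoder for the codebook `C` that maximizes the type-dependent metric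
`q(i, P̂_{x_v y})`, where `P_i` is the type of `v`; ties may be broken in any way. -/
def IsMetricDecoder (q : (V → ℝ) → (X × Y → ℝ) → EReal) {k n : ℕ} (C : Codebook V X k n)
    (φ : (Fin n → Y) → (Fin k → V)) : Prop :=
  ∀ (y : Fin n → Y) (v : Fin k → V),
    q (empType v) (jointType (C v) y) ≤ q (empType (φ y)) (jointType (C (φ y)) y)

/-- The generalized maximum mutual information metric `q(i, P) = I(P) - R_i`. -/
noncomputable def mmiMetric (k n : ℕ) (P : V → ℝ) (J : X × Y → ℝ) : EReal :=
  ((mutualInfo J - rate k n P : ℝ) : EReal)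

open Classical in
/-- The metric `q(i, P) = E_P[log W(Y|X)] - 2 R_i`, with `log 0 = -∞` and `0 log 0 = 0`. -/
noncomputable def likelihoodMetric (W : X → Y → ℝ) (k n : ℕ) (P : V → ℝ) (J : X × Y → ℝ) : EReal :=
  if ∀ z, W z.1 z.2 = 0 → J z = 0 then
    (((∑ z, J z * Real.log (W z.1 z.2)) - 2 * rate k n P : ℝ) : EReal)
  else ⊥

end Codes

/-! ### The random Gilbert-Varshamov ensemble -/

section Ensemble

variable {V X Y : Type*} [Fintype V] [Fintype X] [Fintype Y]

open Classical in
/-- The set from which the codeword of the message `v` is drawn, given the codewords of the messages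
that precede `v` in the order `σ`: the sequences of type `Q_{μ(i)}`, where `P_i` is the type of `v`,
that are at distance greater than `max(Δ_i, Δ_j)` from the codeword of each preceding message `u`,
where `P_j` is the type of `u`. -/
noncomputable def drawSet {m k n N : ℕ} (σ : (Fin k → V) ≃ Fin N) (Q : Fin m → X → ℝ)
    (μ : (V → ℝ) → Fin m) (d : (X × X → ℝ) → ℝ) (Δ : (V → ℝ) → ℝ) (C : Codebook V X k n)
    (v : Fin k → V) : Finset (Fin n → X) :=
  (typeClass n (Q (μ (empType v)))).filter fun x =>
    ∀ u, σ u < σ v → max (Δ (empType v)) (Δ (empType u)) < d (jointType (C u) x)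

open Classical in
/-- The probability of the codebook `C` when the codewords are drawn one after the other in the
order `σ`, each one equiprobably from its `drawSet`. -/
noncomputable def rgvProb {m k n N : ℕ} (σ : (Fin k → V) ≃ Fin N) (Q : Fin m → X → ℝ)
    (μ : (V → ℝ) → Fin m) (d : (X × X → ℝ) → ℝ) (Δ : (V → ℝ) → ℝ) (C : Codebook V X k n) : ℝ :=
  ∏ v, if C v ∈ drawSet σ Q μ d Δ C v then ((drawSet σ Q μ d Δ C v).card : ℝ)⁻¹ else 0

open Classical in
/-- The construction produces all codewords with probability one (no set from which a codeword
has to be drawn is ever empty). -/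
def RgvWellDefined {m k N : ℕ} (n : ℕ) (σ : (Fin k → V) ≃ Fin N) (Q : Fin m → X → ℝ)
    (μ : (V → ℝ) → Fin m) (d : (X × X → ℝ) → ℝ) (Δ : (V → ℝ) → ℝ) : Prop :=
  ∑ C : Codebook V X k n, rgvProb σ Q μ d Δ C = 1

open Classical in
/-- Average over the ensemble of the error probability, when the codebook `C` is used with the
decoder `φ C`. -/
noncomputable def rgvErrorProb (PV : V → ℝ) (W : X → Y → ℝ) {m k n N : ℕ}
    (σ : (Fin k → V) ≃ Fin N) (Q : Fin m → X → ℝ) (μ : (V → ℝ) → Fin m) (d : (X × X → ℝ) → ℝ)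
    (Δ : (V → ℝ) → ℝ) (φ : Codebook V X k n → (Fin n → Y) → (Fin k → V)) : ℝ :=
  ∑ C : Codebook V X k n, rgvProb σ Q μ d Δ C * errorProb PV W C (φ C)

/-- `ζ_n = N_k (n + 1)^(|𝒳|² + |𝒳|)`, where `N_k` is the number of types of sequences in `𝒱^k`. -/
noncomputable def zeta (V X : Type*) [Fintype V] [Fintype X] (k n : ℕ) : ℝ :=
  ((types V k).card : ℝ) * ((n : ℝ) + 1) ^ (Fintype.card X ^ 2 + Fintype.card X)

open Classical in
/-- The condition on `(d, {Δ_i}, δ)` that bounds, for each `c`, the number of sequences of type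
`Q_c` that violate the distance constraints:
`∑_j ∑_{x̄ ∈ 𝒯ⁿ(Q_c), d(x̄, x̃_j) ≤ Δ_j} |𝒯ᵏ(P_j)| ≤ ζ_n |𝒯ⁿ(Q_c)| e^{-nδ}`
for all choices of the sequences `x̃_j ∈ 𝒯ⁿ(Q_{μ(j)})`. -/
def RgvCondition {m : ℕ} (k n : ℕ) (Q : Fin m → X → ℝ) (μ : (V → ℝ) → Fin m)
    (d : (X × X → ℝ) → ℝ) (Δ : (V → ℝ) → ℝ) (δ : ℝ) : Prop :=
  ∀ (c : Fin m) (xt : (V → ℝ) → (Fin n → X)),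
    (∀ P ∈ types V k, xt P ∈ typeClass n (Q (μ P))) →
    ∑ P ∈ types V k,
        ∑ _x ∈ (typeClass n (Q c)).filter (fun x => d (jointType x (xt P)) ≤ Δ P),
          ((typeClass k P).card : ℝ)
      ≤ zeta V X k n * (typeClass n (Q c)).card * Real.exp (-(n * δ))

/-- The distance `d(P) = -I(P)`. -/
noncomputable def miDist (P : X × X → ℝ) : ℝ := -mutualInfo P

/-- The minimum distances `Δ_i = -(R_i + δ)`. -/
noncomputable def miThreshold (k n : ℕ) (δ : ℝ) (P : V → ℝ) : ℝ := -(rate k n P + δ)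

end Ensemble

end RGV

/-! The proof combines the method of types with one property of the ensemble: any two codewords are
jointly distributed, up to a factor 4, like independent uniform draws, and yet their mutual
information is bounded.

For a fixed sequence, the fraction of a type class whose mutual information with it is at least `R_j
+ δ` is at most a polynomial times `exp(-n (R_j + δ))`. Codewords are drawn by non-decreasing rate,
so an earlier message of type `P_j` forbids only such a fraction. At most `exp(n R_j)` messages have
that type, hence all earlier codewords together forbid a fraction at most `ζ_n exp(-n δ)`,
eventually at most 1/2 (`card_typeClass_le_two_mul_card_drawSet`). Every draw is therefore possible
and uniform on at least half of a type class, which gives the factor 4 (`sum_drawProb_eq_le`,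
`sum_rgvProb_pair_le`). The maximum of the two thresholds yields `I(C v; C u) < R_v + δ` in
whichever order `u` and `v` were drawn (`mutualInfo_lt_of_rgvProb_ne_zero`).

Both error bounds are union bounds over competitors `u`. Under the MMI metric a competitor wins with
probability about `exp(-n (I(x; y) - R_v + R_u))`. Under the likelihood metric the pairwise error is
at most a Bhattacharyya product times `exp(n (R_v - R_u))`, and the mutual information constraint
restricts the joint types that occur. In both cases `exp(-n R_u)` sums over all messages to at most
the number of source types (`sum_exp_rate_le`), so only polynomial factors are lost
(`msgErrorProb_mmi_le`, `msgErrorProb_likelihood_le`).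

For `δ → 0` the expurgated exponents must converge uniformly, since `Q`, `μ` and the rates vary with
`n`. Mixing a joint law with the product of its marginals lowers its mutual information at a small
cost in mean Bhattacharyya distance (`eventually_expurgatedExponent_le`). Finally, a codebook no
worse than average is selected for the better decoder. -/

namespace RGV

set_option linter.unusedSectionVars false

/-! ### Sizes of type classes. -/

section TypeCounting

open Classical

variable {α : Type*}

/-- The number of occurrences of a letter in a sequence. -/
noncomputable def occ {n : ℕ} (x : Fin n → α) (a : α) : ℕ :=
  (Finset.univ.filter fun i => x i = a).card

lemma empType_apply {n : ℕ} (x : Fin n → α) (a : α) : empType x a = (occ x a : ℝ) / n := rfl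

lemma occ_le {n : ℕ} (x : Fin n → α) (a : α) : occ x a ≤ n := by
  simpa [occ] using Finset.card_filter_le (Finset.univ : Finset (Fin n)) fun i => x i = a

lemma exists_of_empType_ne_zero {n : ℕ} {x : Fin n → α} {a : α} (h : empType x a ≠ 0) :
    ∃ i, x i = a := by
  have : occ x a ≠ 0 := fun h0 => h (by simp [empType_apply, h0])
  obtain ⟨i, hi⟩ := Finset.card_pos.1 (Nat.pos_of_ne_zero this)
  exact ⟨i, (Finset.mem_filter.1 hi).2⟩

lemma prod_comp_eq_prod_pow [Fintype α] {M : Type*} [CommMonoid M] {n : ℕ} (w : α → M)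
    (x : Fin n → α) : ∏ i, w (x i) = ∏ a, w a ^ occ x a := by
  rw [← Finset.prod_fiberwise Finset.univ x fun i => w (x i)]
  refine Finset.prod_congr rfl fun a _ => ?_
  rw [Finset.prod_congr rfl (g := fun _ => w a), Finset.prod_const]
  · rfl
  · intro i hi
    rw [(Finset.mem_filter.1 hi).2]

lemma sum_occ [Fintype α] {n : ℕ} (x : Fin n → α) : ∑ a, occ x a = n := by
  have := Finset.card_eq_sum_card_fiberwise (s := Finset.univ) (t := Finset.univ) (f := x)
    (fun _ _ => Finset.mem_coe.2 (Finset.mem_univ _))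
  simpa [occ] using this.symm

lemma empType_nonneg {n : ℕ} (x : Fin n → α) (a : α) : 0 ≤ empType x a := by
  rw [empType_apply]; positivity

lemma empType_mem_stdSimplex [Fintype α] {n : ℕ} (hn : n ≠ 0) (x : Fin n → α) :
    empType x ∈ stdSimplex ℝ α := by
  refine ⟨empType_nonneg x, ?_⟩
  simp only [empType_apply]
  rw [← Finset.sum_div, ← Nat.cast_sum, sum_occ, div_self (by exact_mod_cast hn)]

lemma empType_eq_iff {n : ℕ} (x y : Fin n → α) : empType x = empType y ↔ occ x = occ y := by
  constructor
  · intro h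
    -- At length 0 every type is the zero function because of division by zero, but there is only
    -- one sequence.
    rcases Nat.eq_zero_or_pos n with rfl | hn
    · rw [Subsingleton.elim x y]
    funext a
    have h2 := congrFun h a
    simp only [empType_apply] at h2
    have hn' : (n : ℝ) ≠ 0 := by positivity
    rw [div_left_inj' hn'] at h2
    exact_mod_cast h2
  · intro h
    funext a
    simp only [empType_apply, h]

lemma mem_typeClass [Fintype α] {n : ℕ} {Q : α → ℝ} {x : Fin n → α} :
    x ∈ typeClass n Q ↔ empType x = Q := by simp [typeClass]

lemma mem_types [Fintype α] {n : ℕ} {Q : α → ℝ} :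
    Q ∈ types α n ↔ ∃ x : Fin n → α, empType x = Q := by simp [types]

lemma empType_mem_types [Fintype α] {n : ℕ} (x : Fin n → α) : empType x ∈ types α n :=
  mem_types.2 ⟨x, rfl⟩

lemma types_subset_stdSimplex [Fintype α] {n : ℕ} (hn : n ≠ 0) {Q : α → ℝ}
    (hQ : Q ∈ types α n) : Q ∈ stdSimplex ℝ α := by
  obtain ⟨x, rfl⟩ := mem_types.1 hQ
  exact empType_mem_stdSimplex hn x

lemma typeClass_card_pos [Fintype α] {n : ℕ} {Q : α → ℝ} (hQ : Q ∈ types α n) :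
    0 < (typeClass n Q).card := by
  obtain ⟨x, hx⟩ := mem_types.1 hQ
  exact Finset.card_pos.2 ⟨x, mem_typeClass.2 hx⟩

lemma sum_types_typeClass [Fintype α] {M : Type*} [AddCommMonoid M] {n : ℕ}
    (f : (Fin n → α) → M) : ∑ P ∈ types α n, ∑ x ∈ typeClass n P, f x = ∑ x, f x :=
  Finset.sum_fiberwise_of_maps_to (fun x _ => empType_mem_types x) f

lemma card_types_le (α : Type*) [Fintype α] (n : ℕ) :
    (types α n).card ≤ (n + 1) ^ Fintype.card α := by
  have h : types α n ⊆ Finset.univ.image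
      fun (c : α → Fin (n + 1)) (a : α) => ((c a : ℕ) : ℝ) / n := by
    intro Q hQ
    obtain ⟨x, rfl⟩ := mem_types.1 hQ
    exact Finset.mem_image.2
      ⟨fun a => ⟨occ x a, Nat.lt_succ_of_le (occ_le x a)⟩, Finset.mem_univ _, rfl⟩
  refine (Finset.card_le_card h).trans (Finset.card_image_le.trans ?_)
  simp

/-- Positions carrying the same letter are matched by a bijection, letter by letter. This is the
transitivity of the symmetric group on a type class. -/
lemma exists_perm_of_occ_eq {n : ℕ} {x y : Fin n → α} (h : occ x = occ y) :
    ∃ g : Equiv.Perm (Fin n), x ∘ g = y := by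
  have e : ∀ a, Nonempty ({i // y i = a} ≃ {i // x i = a}) := fun a => by
    refine ⟨Fintype.equivOfCardEq ?_⟩
    have := congrFun h a
    simp only [occ] at this
    rw [Fintype.card_subtype, Fintype.card_subtype, this]
  refine ⟨Equiv.ofFiberEquiv fun a => (e a).some, ?_⟩
  funext i
  exact Equiv.ofFiberEquiv_map _ i

/-- Orbit-stabilizer: the type class is the orbit of `x` under permutations of positions, and the
stabilizer permutes the positions of each letter separately. -/
lemma card_typeClass_mul_prod_factorial [Fintype α] {n : ℕ} (x : Fin n → α) :
    (typeClass n (empType x)).card * ∏ a, (occ x a).factorial = n.factorial := by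
  have hst : Fintype.card {g : Equiv.Perm (Fin n) // x ∘ g = x} = ∏ a, (occ x a).factorial := by
    rw [DomMulAct.stabilizer_card x]
    refine Finset.prod_congr rfl fun a _ => ?_
    rw [Fintype.card_subtype, occ]
  have h := Finset.card_eq_sum_card_fiberwise (s := (Finset.univ : Finset (Equiv.Perm (Fin n))))
    (t := typeClass n (empType x)) (f := fun g : Equiv.Perm (Fin n) => x ∘ g) (by
      intro g _
      rw [Finset.mem_coe, mem_typeClass, empType_eq_iff]
      funext a
      simp only [occ]
      exact Finset.card_equiv g (by simp))
  rw [Finset.card_univ, Fintype.card_perm, Fintype.card_fin] at h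
  rw [h, ← hst, ← smul_eq_mul, ← Finset.sum_const]
  refine Finset.sum_congr rfl fun y hy => ?_
  rw [mem_typeClass, empType_eq_iff] at hy
  obtain ⟨g₀, rfl⟩ := exists_perm_of_occ_eq hy.symm
  rw [Fintype.card_subtype]
  -- The permutations taking `x` to `x ∘ g₀` form a translate of the stabilizer by `g₀`.
  refine Finset.card_equiv (Equiv.mulRight g₀) ?_
  intro g
  simp only [Finset.mem_filter, Finset.mem_univ, true_and, Equiv.coe_mulRight, Equiv.Perm.coe_mul]
  rw [← Function.comp_assoc]
  exact ⟨fun h => by rw [h], fun h => g₀.surjective.injective_comp_right h⟩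

lemma factorial_mul_pow_le (l m : ℕ) : l.factorial * l ^ m ≤ m.factorial * l ^ l := by
  rcases le_total l m with h | h
  · calc l.factorial * l ^ m = (l.factorial * l ^ (m - l)) * l ^ l := by
          rw [mul_assoc, ← pow_add, Nat.sub_add_cancel h]
      _ ≤ _ := Nat.mul_le_mul_right _ (Nat.factorial_mul_pow_sub_le_factorial h)
  · have h1 := Nat.factorial_mul_descFactorial (Nat.sub_le l m)
    rw [Nat.sub_sub_self h] at h1
    calc l.factorial * l ^ m = m.factorial * (l.descFactorial (l - m) * l ^ m) := by
          rw [← h1, mul_assoc]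
      _ ≤ m.factorial * (l ^ (l - m) * l ^ m) := by
          gcongr; exact Nat.descFactorial_le_pow _ _
      _ = _ := by rw [← pow_add, Nat.sub_add_cancel h]

/-- Under the memoryless law given by the type of `x`, no type class is more probable than that of
`x` itself. Multiplied by the factorials, the claim splits into `factorial_mul_pow_le` for each
letter. -/
lemma card_typeClass_mul_prod_le [Fintype α] {n : ℕ} (x y : Fin n → α) :
    (typeClass n (empType y)).card * ∏ a, occ x a ^ occ y a ≤
      (typeClass n (empType x)).card * ∏ a, occ x a ^ occ x a := by
  have hx := card_typeClass_mul_prod_factorial x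
  have hy := card_typeClass_mul_prod_factorial y
  have hpos : 0 < (∏ a, (occ y a).factorial) * ∏ a, (occ x a).factorial :=
    Nat.mul_pos (Finset.prod_pos fun a _ => Nat.factorial_pos _)
      (Finset.prod_pos fun a _ => Nat.factorial_pos _)
  refine Nat.le_of_mul_le_mul_right ?_ hpos
  calc _ = ((typeClass n (empType y)).card * ∏ a, (occ y a).factorial) *
        ∏ a, ((occ x a).factorial * occ x a ^ occ y a) := by
          rw [Finset.prod_mul_distrib]; ring
    _ ≤ ((typeClass n (empType x)).card * ∏ a, (occ x a).factorial) *
        ∏ a, ((occ y a).factorial * occ x a ^ occ x a) := by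
          rw [hx, hy]
          exact Nat.mul_le_mul_left _ (Finset.prod_le_prod' fun a _ => factorial_mul_pow_le _ _)
    _ = _ := by rw [Finset.prod_mul_distrib]; ring

/-- Positivity is needed only for letters that occur: the others enter with exponent 0 on the left
and coefficient 0 on the right. -/
lemma prod_eq_exp [Fintype α] {n : ℕ} (hn : n ≠ 0) (x : Fin n → α) (w : α → ℝ)
    (hw : ∀ a, empType x a ≠ 0 → 0 < w a) :
    ∏ i, w (x i) = Real.exp (n * ∑ a, empType x a * Real.log (w a)) := by
  rw [prod_comp_eq_prod_pow, Finset.mul_sum, Real.exp_sum]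
  refine Finset.prod_congr rfl fun a _ => ?_
  have hn' : (n : ℝ) ≠ 0 := by exact_mod_cast hn
  by_cases h : empType x a = 0
  · rw [h]
    rw [empType_apply, div_eq_zero_iff, or_iff_left hn'] at h
    have h0 : occ x a = 0 := by exact_mod_cast h
    simp [h0]
  · rw [empType_apply, ← mul_assoc, mul_div_cancel₀ _ hn', Real.exp_nat_mul,
      Real.exp_log (hw a h)]

lemma prod_empType [Fintype α] {n : ℕ} (hn : n ≠ 0) (x : Fin n → α) :
    ∏ i, empType x (x i) = Real.exp (-(n * entropy (empType x))) := by
  rw [prod_eq_exp hn x _ fun a h => lt_of_le_of_ne (empType_nonneg x a) (Ne.symm h)]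
  simp [entropy, Real.negMulLog, Finset.sum_neg_distrib]

lemma sum_prod_eq_one [Fintype α] {n : ℕ} {Q : α → ℝ} (hQ : Q ∈ stdSimplex ℝ α) :
    ∑ x : Fin n → α, ∏ i, Q (x i) = 1 := by
  have h := Finset.prod_univ_sum (fun _ : Fin n => (Finset.univ : Finset α)) fun _ a => Q a
  rw [Fintype.piFinset_univ] at h
  rw [← h]
  simp [hQ.2]

/-- Under the memoryless law `Q` each member of the class has probability `exp(-n H(Q))`, and the
total is at most 1. -/
lemma card_typeClass_le [Fintype α] {n : ℕ} (hn : n ≠ 0) {Q : α → ℝ} (hQ : Q ∈ types α n) :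
    ((typeClass n Q).card : ℝ) ≤ Real.exp (n * entropy Q) := by
  have hs := types_subset_stdSimplex hn hQ
  have h1 : ∑ x ∈ typeClass n Q, ∏ i, Q (x i) ≤ 1 := by
    rw [← sum_prod_eq_one (n := n) hs]
    exact Finset.sum_le_sum_of_subset_of_nonneg (Finset.subset_univ _)
      fun x _ _ => Finset.prod_nonneg fun i _ => hs.1 _
  rw [Finset.sum_congr rfl (g := fun _ => Real.exp (-(n * entropy Q))), Finset.sum_const,
    nsmul_eq_mul, Real.exp_neg, ← div_eq_mul_inv, div_le_one (Real.exp_pos _)] at h1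
  · exact h1
  · intro x hx
    obtain rfl := mem_typeClass.1 hx
    exact prod_empType hn x

/-- Under the law `Q` the class of `Q` is the most probable one, so its probability is at least the
reciprocal of the number of types. -/
lemma exp_entropy_le_card_typeClass [Fintype α] {n : ℕ} (hn : n ≠ 0) {Q : α → ℝ}
    (hQ : Q ∈ types α n) :
    Real.exp (n * entropy Q) ≤ ((n : ℝ) + 1) ^ Fintype.card α * (typeClass n Q).card := by
  obtain ⟨x, rfl⟩ := mem_types.1 hQ
  have hs := empType_mem_stdSimplex hn x
  set Q := empType x with hQdef
  have hcl : ∀ P ∈ types α n, ∑ y ∈ typeClass n P, ∏ i, Q (y i) ≤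
      (typeClass n Q).card * Real.exp (-(n * entropy Q)) := by
    intro P hP
    obtain ⟨y, rfl⟩ := mem_types.1 hP
    have hsum : ∀ z : Fin n → α, ∑ y ∈ typeClass n (empType z), ∏ i, Q (y i) =
        (typeClass n (empType z)).card * ∏ a, Q a ^ occ z a := by
      intro z
      rw [Finset.sum_congr rfl (g := fun _ => ∏ a, Q a ^ occ z a), Finset.sum_const, nsmul_eq_mul]
      intro y hy
      rw [prod_comp_eq_prod_pow, (empType_eq_iff _ _).1 (mem_typeClass.1 hy)]
    -- The denominator `n ^ n` is the same for all sequences, which reduces the comparison to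
    -- natural numbers.
    have hpow : ∀ z : Fin n → α, ∏ a, Q a ^ occ z a =
        ((∏ a, occ x a ^ occ z a : ℕ) : ℝ) / (n : ℝ) ^ n := by
      intro z
      simp only [hQdef, empType_apply, div_pow]
      rw [Finset.prod_div_distrib, Finset.prod_pow_eq_pow_sum, sum_occ]
      push_cast
      rfl
    rw [hsum y, ← prod_empType hn x, prod_comp_eq_prod_pow, hpow, ← hQdef, hpow, ← mul_div_assoc,
      ← mul_div_assoc]
    refine div_le_div_of_nonneg_right ?_ (by positivity)
    exact_mod_cast card_typeClass_mul_prod_le x y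
  have h1 : (1 : ℝ) ≤ ((n : ℝ) + 1) ^ Fintype.card α *
      ((typeClass n Q).card * Real.exp (-(n * entropy Q))) := by
    calc (1 : ℝ) = ∑ P ∈ types α n, ∑ y ∈ typeClass n P, ∏ i, Q (y i) := by
          rw [sum_types_typeClass, sum_prod_eq_one hs]
      _ ≤ (types α n).card * ((typeClass n Q).card * Real.exp (-(n * entropy Q))) := by
          rw [← nsmul_eq_mul, ← Finset.sum_const]
          exact Finset.sum_le_sum hcl
      _ ≤ _ := by
          gcongr
          exact_mod_cast card_types_le α n
  rwa [← mul_assoc, Real.exp_neg, ← div_eq_mul_inv, one_le_div (Real.exp_pos _)] at h1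

end TypeCounting

/-! ### Exponentials of extended-real exponents. -/

section ExpNeg

lemma expNeg_coe (n : ℕ) (x : ℝ) : expNeg n x = ENNReal.ofReal (Real.exp (-(n * x))) := by
  rw [expNeg, ← EReal.coe_mul, EReal.exp_coe, neg_mul]

lemma expNeg_top {n : ℕ} (hn : n ≠ 0) : expNeg n ⊤ = 0 := by
  have : (0 : ℝ) < n := by positivity
  rw [expNeg, EReal.coe_mul_top_of_neg (by linarith), EReal.exp_bot]

lemma expNeg_bot {n : ℕ} (hn : n ≠ 0) : expNeg n ⊥ = ⊤ := by
  have : (0 : ℝ) < n := by positivity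
  rw [expNeg, EReal.coe_mul_bot_of_neg (by linarith), EReal.exp_top]

lemma expNeg_antitone (n : ℕ) : Antitone (expNeg n) := by
  intro a b hab
  refine EReal.exp_monotone ?_
  rw [EReal.coe_neg, EReal.neg_mul, EReal.neg_mul, EReal.neg_le_neg_iff]
  exact mul_le_mul_of_nonneg_left hab (by exact_mod_cast n.cast_nonneg)

/-- Equality fails for opposite infinities: the left side is `0 * ⊤ = 0`, whereas `⊥ + ⊤ = ⊥` makes
the right side `⊤`. -/
lemma expNeg_mul_le {n : ℕ} (hn : n ≠ 0) (a b : EReal) :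
    expNeg n a * expNeg n b ≤ expNeg n (a + b) := by
  induction a with
  | bot => rw [EReal.bot_add, expNeg_bot hn]; exact le_top
  | top =>
    rw [expNeg_top hn, zero_mul]; exact zero_le
  | coe a =>
    induction b with
    | bot => rw [EReal.add_bot, expNeg_bot hn]; exact le_top
    | top => rw [expNeg_top hn, mul_zero]; exact zero_le
    | coe b =>
      rw [← EReal.coe_add, expNeg_coe, expNeg_coe, expNeg_coe,
        ← ENNReal.ofReal_mul (Real.exp_pos _).le, ← Real.exp_add]
      exact le_of_eq (by ring_nf)

lemma expNeg_rescale {k n : ℕ} (hn : n ≠ 0) (a : EReal) :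
    expNeg k a = expNeg n ((((k : ℝ) / n : ℝ) : EReal) * a) := by
  have hn' : (n : ℝ) ≠ 0 := by exact_mod_cast hn
  rw [expNeg, expNeg, ← mul_assoc, ← EReal.coe_mul]
  congr 3
  field_simp

end ExpNeg

/-! ### Joint types and conditional type classes. -/

section JointTypes

open Classical

variable {α β : Type*} [Fintype α] [Fintype β]

lemma sum_mul_fst (J : α × β → ℝ) (f : α → ℝ) : ∑ z, J z * f z.1 = ∑ a, marg₁ J a * f a := by
  rw [Fintype.sum_prod_type]
  simp only [marg₁, Finset.sum_mul]

lemma sum_mul_snd (J : α × β → ℝ) (f : β → ℝ) : ∑ z, J z * f z.2 = ∑ b, marg₂ J b * f b := by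
  rw [Fintype.sum_prod_type_right]
  simp only [marg₂, Finset.sum_mul]

lemma marg₁_jointType {n : ℕ} (x : Fin n → α) (y : Fin n → β) :
    marg₁ (jointType x y) = empType x := by
  funext a
  simp only [marg₁, jointType, empType_apply]
  rw [← Finset.sum_div, ← Nat.cast_sum]
  congr 2
  simp only [occ]
  rw [Finset.card_eq_sum_card_fiberwise (f := y) (t := Finset.univ)
    (fun _ _ => Finset.mem_coe.2 (Finset.mem_univ _))]
  refine Finset.sum_congr rfl fun b _ => ?_
  rw [Finset.filter_filter]
  simp

lemma jointType_swap {n : ℕ} (x : Fin n → α) (y : Fin n → β) (z : α × β) :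
    jointType y x z.swap = jointType x y z := by
  obtain ⟨a, b⟩ := z
  simp only [jointType, empType_apply, occ, Prod.swap, Prod.mk.injEq, and_comm]

lemma marg₂_jointType {n : ℕ} (x : Fin n → α) (y : Fin n → β) :
    marg₂ (jointType x y) = empType y := by
  rw [← marg₁_jointType y x]
  funext b
  simp only [marg₁, marg₂]
  exact Finset.sum_congr rfl fun a _ => (jointType_swap x y (a, b)).symm

lemma entropy_jointType_swap {n : ℕ} (x : Fin n → α) (y : Fin n → β) :
    entropy (jointType y x) = entropy (jointType x y) := by
  simp only [entropy]
  rw [← (Equiv.prodComm α β).sum_comp]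
  exact Finset.sum_congr rfl fun z _ => by rw [Equiv.prodComm_apply, jointType_swap]

lemma mutualInfo_jointType_swap {n : ℕ} (x : Fin n → α) (y : Fin n → β) :
    mutualInfo (jointType y x) = mutualInfo (jointType x y) := by
  rw [mutualInfo, mutualInfo, entropy_jointType_swap, marg₁_jointType, marg₁_jointType,
    marg₂_jointType, marg₂_jointType]
  ring

lemma jointType_mem_types {n : ℕ} (x : Fin n → α) (y : Fin n → β) :
    jointType x y ∈ types (α × β) n := empType_mem_types _

lemma le_marg₁ {J : α × β → ℝ} (hJ : ∀ z, 0 ≤ J z) (z : α × β) : J z ≤ marg₁ J z.1 :=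
  Finset.single_le_sum (f := fun b => J (z.1, b)) (fun _ _ => hJ _) (Finset.mem_univ z.2)

lemma le_marg₂ {J : α × β → ℝ} (hJ : ∀ z, 0 ≤ J z) (z : α × β) : J z ≤ marg₂ J z.2 :=
  Finset.single_le_sum (f := fun a => J (a, z.2)) (fun _ _ => hJ _) (Finset.mem_univ z.1)

lemma marg₁_mem_stdSimplex {J : α × β → ℝ} (hJ : J ∈ stdSimplex ℝ (α × β)) :
    marg₁ J ∈ stdSimplex ℝ α := by
  refine ⟨fun a => Finset.sum_nonneg fun b _ => hJ.1 _, ?_⟩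
  rw [← hJ.2, Fintype.sum_prod_type]; rfl

lemma marg₂_mem_stdSimplex {J : α × β → ℝ} (hJ : J ∈ stdSimplex ℝ (α × β)) :
    marg₂ J ∈ stdSimplex ℝ β := by
  refine ⟨fun a => Finset.sum_nonneg fun b _ => hJ.1 _, ?_⟩
  rw [← hJ.2, Fintype.sum_prod_type_right]; rfl

/-- The number of sequences in a conditional type class. -/
lemma card_condTypeClass_le {n : ℕ} (hn : n ≠ 0) (x : Fin n → α) (J : α × β → ℝ) :
    ((Finset.univ.filter fun y : Fin n → β => jointType x y = J).card : ℝ) ≤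
      Real.exp (n * (entropy J - entropy (marg₁ J))) := by
  rcases (Finset.univ.filter fun y : Fin n → β => jointType x y = J).eq_empty_or_nonempty with
    he | ⟨y₀, hy₀⟩
  · rw [he]; simpa using (Real.exp_pos _).le
  have hy₀ : jointType x y₀ = J := (Finset.mem_filter.1 hy₀).2
  have hJ : ∀ z, 0 ≤ J z := hy₀ ▸ empType_nonneg _
  have hm : marg₁ J = empType x := hy₀ ▸ marg₁_jointType x y₀
  have hterm : ∀ y ∈ Finset.univ.filter fun y : Fin n → β => jointType x y = J,
      ∏ i, J (x i, y i) / marg₁ J (x i) =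
        Real.exp (-(n * (entropy J - entropy (marg₁ J)))) := by
    intro y hy
    have hy : empType (fun i => (x i, y i)) = J := (Finset.mem_filter.1 hy).2
    rw [Finset.prod_div_distrib, hm, prod_empType hn x]
    have := prod_empType hn fun i => (x i, y i)
    rw [hy] at this
    rw [this, ← Real.exp_sub]
    ring_nf
  -- The conditional law has row sums 1, or 0 where the marginal vanishes, since division by zero
  -- gives 0; hence only an inequality.
  have hle : ∑ y : Fin n → β, ∏ i, J (x i, y i) / marg₁ J (x i) ≤ 1 := by
    have h := Finset.prod_univ_sum (fun _ : Fin n => (Finset.univ : Finset β))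
      fun i b => J (x i, b) / marg₁ J (x i)
    rw [Fintype.piFinset_univ] at h
    rw [← h]
    refine Finset.prod_le_one (fun i _ => Finset.sum_nonneg fun b _ => ?_) fun i _ => ?_
    · exact div_nonneg (hJ _) ((hJ _).trans (le_marg₁ hJ (x i, b)))
    · rw [← Finset.sum_div]
      exact div_self_le_one _
  have h1 : ∑ y ∈ Finset.univ.filter (fun y : Fin n → β => jointType x y = J),
      ∏ i, J (x i, y i) / marg₁ J (x i) ≤ 1 :=
    (Finset.sum_le_sum_of_subset_of_nonneg (Finset.subset_univ _) fun y _ _ =>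
      Finset.prod_nonneg fun i _ =>
        div_nonneg (hJ _) ((hJ _).trans (le_marg₁ hJ (x i, y i)))).trans hle
  rwa [Finset.sum_congr rfl hterm, Finset.sum_const, nsmul_eq_mul, Real.exp_neg,
    ← div_eq_mul_inv, div_le_one (Real.exp_pos _)] at h1

lemma card_condTypeClass_le' {n : ℕ} (hn : n ≠ 0) (y : Fin n → β) (J : α × β → ℝ) :
    ((Finset.univ.filter fun x : Fin n → α => jointType x y = J).card : ℝ) ≤
      Real.exp (n * (entropy J - entropy (marg₂ J))) := by
  rcases (Finset.univ.filter fun x : Fin n → α => jointType x y = J).eq_empty_or_nonempty with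
    he | ⟨x₀, hx₀⟩
  · rw [he]; simpa using (Real.exp_pos _).le
  have hx₀ : jointType x₀ y = J := (Finset.mem_filter.1 hx₀).2
  have h := card_condTypeClass_le hn y (jointType y x₀)
  rw [entropy_jointType_swap, marg₁_jointType, ← marg₂_jointType x₀ y, hx₀] at h
  refine le_trans (le_of_eq ?_) h
  congr 2
  ext x
  simp only [Finset.mem_filter, Finset.mem_univ, true_and, ← hx₀]
  constructor
  · intro h; funext z
    exact (jointType_swap y x z).symm.trans ((congrFun h z.swap).trans (jointType_swap y x₀ z))
  · intro h; funext z
    exact (jointType_swap x y z).symm.trans ((congrFun h z.swap).trans (jointType_swap x₀ y z))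

/-- The number of sequences of a given type whose mutual information with a fixed sequence is at
least `s`. -/
lemma card_typeClass_mutualInfo_ge_le {n : ℕ} (hn : n ≠ 0) {Q : α → ℝ} (hQ : Q ∈ types α n)
    (y : Fin n → β) (s : ℝ) :
    (((typeClass n Q).filter fun x => s ≤ mutualInfo (jointType x y)).card : ℝ) ≤
      ((n : ℝ) + 1) ^ (Fintype.card α * Fintype.card β + Fintype.card α) *
        (typeClass n Q).card * Real.exp (-(n * s)) := by
  rw [Finset.card_eq_sum_card_fiberwise (f := fun x => jointType x y) (t := types (α × β) n)
    fun x _ => jointType_mem_types x y, Nat.cast_sum]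
  have hterm : ∀ J ∈ types (α × β) n,
      ((((typeClass n Q).filter fun x => s ≤ mutualInfo (jointType x y)).filter
        fun x => jointType x y = J).card : ℝ) ≤ Real.exp (n * entropy Q) * Real.exp (-(n * s)) := by
    intro J _
    rcases (((typeClass n Q).filter fun x => s ≤ mutualInfo (jointType x y)).filter
        fun x => jointType x y = J).eq_empty_or_nonempty with he | ⟨x₀, hx₀⟩
    · rw [he]; simp only [Finset.card_empty, Nat.cast_zero]; positivity
    simp only [Finset.mem_filter, mem_typeClass] at hx₀
    obtain ⟨⟨hxQ, hs⟩, hJ⟩ := hx₀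
    have hm : marg₁ J = Q := by rw [← hJ, marg₁_jointType, hxQ]
    rw [hJ, mutualInfo, hm] at hs
    calc _ ≤ ((Finset.univ.filter fun x : Fin n → α => jointType x y = J).card : ℝ) := by
          exact_mod_cast Finset.card_le_card
            fun x hx => Finset.mem_filter.2 ⟨Finset.mem_univ _, (Finset.mem_filter.1 hx).2⟩
      _ ≤ Real.exp (n * (entropy J - entropy (marg₂ J))) := card_condTypeClass_le' hn y J
      -- `H(J)` minus the entropy of the second marginal equals `H(Q) - I(J)`.
      _ ≤ Real.exp (n * entropy Q + -(n * s)) := by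
          refine Real.exp_le_exp.2 ?_
          have : (n : ℝ) * (entropy J - entropy (marg₂ J)) ≤ n * (entropy Q - s) :=
            mul_le_mul_of_nonneg_left (by linarith) n.cast_nonneg
          linarith
      _ = _ := Real.exp_add _ _
  refine (Finset.sum_le_sum hterm).trans ?_
  rw [Finset.sum_const, nsmul_eq_mul, pow_add, ← mul_assoc]
  refine mul_le_mul_of_nonneg_right ?_ (Real.exp_pos _).le
  rw [mul_assoc]
  refine mul_le_mul ?_ (exp_entropy_le_card_typeClass hn hQ) (Real.exp_pos _).le (by positivity)
  have := card_types_le (α × β) n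
  rw [Fintype.card_prod] at this
  exact_mod_cast this

end JointTypes

/-! ### Relative entropy, mutual information, and probabilities of type classes. -/

section Divergence

open Classical

variable {α β : Type*} [Fintype α] [Fintype β]

lemma sum_mul_log_div {P g : α → ℝ} (h : ∀ a, P a ≠ 0 → g a ≠ 0) :
    ∑ a, P a * Real.log (P a / g a) = -entropy P - ∑ a, P a * Real.log (g a) := by
  rw [entropy, ← Finset.sum_neg_distrib, ← Finset.sum_sub_distrib]
  refine Finset.sum_congr rfl fun a _ => ?_
  by_cases hP : P a = 0
  · simp [hP]
  · rw [Real.log_div hP (h a hP), Real.negMulLog]; ring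

lemma mutualInfo_eq_sum {J : α × β → ℝ} (hJ : ∀ z, 0 ≤ J z) :
    mutualInfo J = ∑ z, J z * Real.log (J z / (marg₁ J z.1 * marg₂ J z.2)) := by
  have h1 : ∀ z, J z ≠ 0 → marg₁ J z.1 ≠ 0 := fun z hz =>
    ((lt_of_le_of_ne (hJ z) (Ne.symm hz)).trans_le (le_marg₁ hJ z)).ne'
  have h2 : ∀ z, J z ≠ 0 → marg₂ J z.2 ≠ 0 := fun z hz =>
    ((lt_of_le_of_ne (hJ z) (Ne.symm hz)).trans_le (le_marg₂ hJ z)).ne'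
  rw [sum_mul_log_div (g := fun z => marg₁ J z.1 * marg₂ J z.2)
    fun z hz => mul_ne_zero (h1 z hz) (h2 z hz)]
  have : ∑ z, J z * Real.log (marg₁ J z.1 * marg₂ J z.2) =
      ∑ z, J z * Real.log (marg₁ J z.1) + ∑ z, J z * Real.log (marg₂ J z.2) := by
    rw [← Finset.sum_add_distrib]
    refine Finset.sum_congr rfl fun z _ => ?_
    by_cases hz : J z = 0
    · simp [hz]
    · rw [Real.log_mul (h1 z hz) (h2 z hz), mul_add]
  rw [this, sum_mul_fst J fun a => Real.log (marg₁ J a), sum_mul_snd J fun a => Real.log (marg₂ J a),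
    mutualInfo]
  simp only [entropy, Real.negMulLog, neg_mul, Finset.sum_neg_distrib]
  ring

/-- Relative entropy dominates the squared Hellinger distance. -/
lemma sum_sq_sqrt_sub_le {P Q : α → ℝ} (hP : P ∈ stdSimplex ℝ α) (hQ : Q ∈ stdSimplex ℝ α)
    (h : ∀ a, P a ≠ 0 → Q a ≠ 0) :
    ∑ a, (√(P a) - √(Q a)) ^ 2 ≤ ∑ a, P a * Real.log (P a / Q a) := by
  -- `P` and `Q` have the same total mass; after this rewriting the inequality holds term by term.
  have h1 : ∑ a, (√(P a) - √(Q a)) ^ 2 = ∑ a, (2 * P a - 2 * (√(P a) * √(Q a))) := by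
    have : ∀ a, (√(P a) - √(Q a)) ^ 2 = (2 * P a - 2 * (√(P a) * √(Q a))) + (Q a - P a) := by
      intro a
      rw [sub_sq, Real.sq_sqrt (hP.1 a), Real.sq_sqrt (hQ.1 a)]; ring
    rw [Finset.sum_congr rfl fun a _ => this a, Finset.sum_add_distrib]
    rw [Finset.sum_sub_distrib (f := Q), hP.2, hQ.2, sub_self, add_zero]
  rw [h1]
  refine Finset.sum_le_sum fun a _ => ?_
  by_cases hPa : P a = 0
  · simp [hPa]
  have hp : 0 < P a := lt_of_le_of_ne (hP.1 a) (Ne.symm hPa)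
  have hq : 0 < Q a := lt_of_le_of_ne (hQ.1 a) (Ne.symm (h a hPa))
  have hsp := Real.sqrt_pos.2 hp
  have hsq := Real.sqrt_pos.2 hq
  -- Passing to square roots lets `log t ≤ t - 1` at `t = √(Q a / P a)` give exactly the termwise
  -- bound.
  have hlog : Real.log (P a / Q a) = -2 * Real.log (√(Q a) / √(P a)) := by
    rw [Real.log_div hp.ne' hq.ne', Real.log_div hsq.ne' hsp.ne', Real.log_sqrt hq.le,
      Real.log_sqrt hp.le]
    ring
  have hb := Real.log_le_sub_one_of_pos (div_pos hsq hsp)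
  rw [hlog]
  have h2 : P a * (√(Q a) / √(P a)) = √(P a) * √(Q a) := by
    nth_rewrite 1 [← Real.mul_self_sqrt hp.le]
    field_simp
  nlinarith [mul_le_mul_of_nonneg_left hb hp.le]

lemma product_mem_stdSimplex {P : α → ℝ} {Q : β → ℝ} (hP : P ∈ stdSimplex ℝ α)
    (hQ : Q ∈ stdSimplex ℝ β) : (fun z : α × β => P z.1 * Q z.2) ∈ stdSimplex ℝ (α × β) := by
  refine ⟨fun z => mul_nonneg (hP.1 _) (hQ.1 _), ?_⟩
  rw [Fintype.sum_prod_type]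
  simp only [← Finset.mul_sum, hQ.2, mul_one, hP.2]

lemma sum_sq_sqrt_sub_le_mutualInfo {J : α × β → ℝ} (hJ : J ∈ stdSimplex ℝ (α × β)) :
    ∑ z, (√(J z) - √(marg₁ J z.1 * marg₂ J z.2)) ^ 2 ≤ mutualInfo J := by
  rw [mutualInfo_eq_sum hJ.1]
  refine sum_sq_sqrt_sub_le hJ
    (product_mem_stdSimplex (marg₁_mem_stdSimplex hJ) (marg₂_mem_stdSimplex hJ)) fun z hz => ?_
  have := lt_of_le_of_ne (hJ.1 z) (Ne.symm hz)
  exact mul_ne_zero (this.trans_le (le_marg₁ hJ.1 z)).ne' (this.trans_le (le_marg₂ hJ.1 z)).ne'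

lemma mutualInfo_nonneg {J : α × β → ℝ} (hJ : J ∈ stdSimplex ℝ (α × β)) : 0 ≤ mutualInfo J :=
  (Finset.sum_nonneg fun _ _ => sq_nonneg _).trans (sum_sq_sqrt_sub_le_mutualInfo hJ)

lemma stdSimplex_le_one {P : α → ℝ} (hP : P ∈ stdSimplex ℝ α) (a : α) : P a ≤ 1 :=
  hP.2 ▸ Finset.single_le_sum (fun b _ => hP.1 b) (Finset.mem_univ a)

/-- A Pinsker-type inequality for the mutual information. -/
lemma abs_product_sub_le {J : α × β → ℝ} (hJ : J ∈ stdSimplex ℝ (α × β)) (z : α × β) :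
    |marg₁ J z.1 * marg₂ J z.2 - J z| ≤ 2 * √(mutualInfo J) := by
  have hK := product_mem_stdSimplex (marg₁_mem_stdSimplex hJ) (marg₂_mem_stdSimplex hJ)
  set q := marg₁ J z.1 * marg₂ J z.2 with hq
  have hq0 : 0 ≤ q := hK.1 z
  have hq1 : √q ≤ 1 := Real.sqrt_le_one.2 (stdSimplex_le_one hK z)
  have hp1 : √(J z) ≤ 1 := Real.sqrt_le_one.2 (stdSimplex_le_one hJ z)
  have h1 : |√(J z) - √q| ≤ √(mutualInfo J) := by
    rw [← Real.sqrt_sq_eq_abs]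
    refine Real.sqrt_le_sqrt (le_trans ?_ (sum_sq_sqrt_sub_le_mutualInfo hJ))
    exact Finset.single_le_sum (f := fun z => (√(J z) - √(marg₁ J z.1 * marg₂ J z.2)) ^ 2)
      (fun _ _ => sq_nonneg _) (Finset.mem_univ z)
  have h2 : q - J z = -((√(J z) - √q) * (√(J z) + √q)) := by
    nlinarith [Real.mul_self_sqrt hq0, Real.mul_self_sqrt (hJ.1 z)]
  rw [h2, abs_neg, abs_mul, mul_comm]
  refine mul_le_mul ?_ h1 (abs_nonneg _) zero_le_two
  rw [abs_of_nonneg (by positivity)]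
  linarith

lemma entropy_nonneg {P : α → ℝ} (hP : P ∈ stdSimplex ℝ α) : 0 ≤ entropy P :=
  Finset.sum_nonneg fun a _ => Real.negMulLog_nonneg (hP.1 a) (stdSimplex_le_one hP a)

/-- The probability of a conditional type class under a memoryless channel. -/
lemma sum_condTypeClass_le {n : ℕ} (hn : n ≠ 0) {W : α → β → ℝ} (hW : ∀ a b, 0 ≤ W a b)
    (x : Fin n → α) (J : α × β → ℝ) :
    ENNReal.ofReal (∑ y ∈ Finset.univ.filter (fun y : Fin n → β => jointType x y = J),
      ∏ i, W (x i) (y i)) ≤ expNeg n (relEntropy J fun z => empType x z.1 * W z.1 z.2) := by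
  rcases (Finset.univ.filter fun y : Fin n → β => jointType x y = J).eq_empty_or_nonempty with
    he | ⟨y₀, hy₀⟩
  · rw [he]; simp
  have hy₀ : jointType x y₀ = J := (Finset.mem_filter.1 hy₀).2
  have hJ : ∀ z, 0 ≤ J z := hy₀ ▸ empType_nonneg _
  have hm : marg₁ J = empType x := hy₀ ▸ marg₁_jointType x y₀
  rw [relEntropy]
  have hm0 : ∀ z, J z ≠ 0 → empType x z.1 ≠ 0 := fun z hz => by
    rw [← hm]
    exact ((lt_of_le_of_ne (hJ z) (Ne.symm hz)).trans_le (le_marg₁ hJ z)).ne'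
  split_ifs with hac
  · have hW0 : ∀ z, J z ≠ 0 → W z.1 z.2 ≠ 0 := fun z hz h0 => hz (hac z (by rw [h0, mul_zero]))
    rw [expNeg_coe]
    refine ENNReal.ofReal_le_ofReal ?_
    have hterm : ∀ y ∈ Finset.univ.filter fun y : Fin n → β => jointType x y = J,
        ∏ i, W (x i) (y i) = Real.exp (n * ∑ z, J z * Real.log (W z.1 z.2)) := by
      intro y hy
      have hy : empType (fun i => (x i, y i)) = J := (Finset.mem_filter.1 hy).2
      have h := prod_eq_exp hn (fun i => (x i, y i)) (fun z : α × β => W z.1 z.2)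
        (fun z hz => (hW z.1 z.2).lt_of_ne (hW0 z (by rwa [hy] at hz)).symm)
      rwa [hy] at h
    rw [Finset.sum_congr rfl hterm, Finset.sum_const, nsmul_eq_mul]
    refine (mul_le_mul_of_nonneg_right (card_condTypeClass_le hn x J) (Real.exp_pos _).le).trans ?_
    rw [← Real.exp_add]
    refine Real.exp_le_exp.2 (le_of_eq ?_)
    have hg : ∀ z, J z ≠ 0 → empType x z.1 * W z.1 z.2 ≠ 0 :=
      fun z hz => mul_ne_zero (hm0 z hz) (hW0 z hz)
    have hD := sum_mul_log_div hg
    have : ∑ z, J z * Real.log (empType x z.1 * W z.1 z.2) =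
        ∑ z, J z * Real.log (empType x z.1) + ∑ z, J z * Real.log (W z.1 z.2) := by
      rw [← Finset.sum_add_distrib]
      refine Finset.sum_congr rfl fun z _ => ?_
      by_cases hz : J z = 0
      · simp [hz]
      · rw [Real.log_mul (hm0 z hz) (hW0 z hz), mul_add]
    rw [hD, this, sum_mul_fst J fun a => Real.log (empType x a), hm]
    simp only [entropy, Real.negMulLog, neg_mul, Finset.sum_neg_distrib]
    ring
  -- Here `J` charges a transition of probability 0, so every output sequence in the class has
  -- probability 0.
  · push Not at hac
    obtain ⟨z, hz, hJz⟩ := hac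
    have hWz : W z.1 z.2 = 0 := (mul_eq_zero.1 hz).resolve_left (hm0 z hJz)
    rw [expNeg_top hn, Finset.sum_eq_zero, ENNReal.ofReal_zero]
    intro y hy
    have hy : jointType x y = J := (Finset.mem_filter.1 hy).2
    rw [← hy, jointType] at hJz
    obtain ⟨i, rfl⟩ := exists_of_empType_ne_zero hJz
    exact Finset.prod_eq_zero (Finset.mem_univ i) hWz

/-- The probability of a type class under a memoryless source. -/
lemma sum_typeClass_le {n : ℕ} (hn : n ≠ 0) {PV : α → ℝ} (hPV : ∀ a, 0 ≤ PV a) {P : α → ℝ}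
    (hP : P ∈ types α n) :
    ENNReal.ofReal (∑ v ∈ typeClass n P, ∏ i, PV (v i)) ≤ expNeg n (relEntropy P PV) := by
  rw [relEntropy]
  have hP0 := (types_subset_stdSimplex hn hP).1
  split_ifs with hac
  · rw [expNeg_coe]
    refine ENNReal.ofReal_le_ofReal ?_
    have hterm : ∀ v ∈ typeClass n P,
        ∏ i, PV (v i) = Real.exp (n * ∑ a, P a * Real.log (PV a)) := by
      intro v hv
      obtain rfl := mem_typeClass.1 hv
      exact prod_eq_exp hn v PV fun a ha => lt_of_le_of_ne (hPV a) fun h => ha (hac a h.symm)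
    rw [Finset.sum_congr rfl hterm, Finset.sum_const, nsmul_eq_mul]
    refine (mul_le_mul_of_nonneg_right (card_typeClass_le hn hP) (Real.exp_pos _).le).trans ?_
    rw [← Real.exp_add]
    refine Real.exp_le_exp.2 (le_of_eq ?_)
    rw [sum_mul_log_div fun a ha h => ha (hac a h)]
    ring
  · push Not at hac
    obtain ⟨a, ha, hPa⟩ := hac
    rw [expNeg_top hn, Finset.sum_eq_zero, ENNReal.ofReal_zero]
    intro v hv
    rw [← mem_typeClass.1 hv] at hPa
    obtain ⟨i, rfl⟩ := exists_of_empType_ne_zero hPa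
    exact Finset.prod_eq_zero (Finset.mem_univ i) ha

end Divergence

/-! ### Sequential draws whose sets depend on the earlier outcomes. -/

section SequentialSums

variable {A : Type*} [Fintype A]

/-- The last coordinate is summed out first. The other factors do not see it, so the arbitrary
letter `a₀` may fill its place. This is the induction step for the two results below. -/
lemma sum_prod_adapted_succ {N : ℕ} (a₀ : A) (p : Fin (N + 1) → (Fin (N + 1) → A) → ℝ)
    (hp : ∀ i C C', (∀ j ≤ i, C j = C' j) → p i C = p i C') :
    ∑ C, ∏ i, p i C = ∑ C : Fin N → A,
      (∏ i : Fin N, p i.castSucc (Fin.snoc (α := fun _ => A) C a₀)) *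
        ∑ a, p (Fin.last N)
          (Function.update (Fin.snoc (α := fun _ => A) C a₀) (Fin.last N) a) := by
  rw [← (Fin.snocEquiv fun _ => A).sum_comp, Fintype.sum_prod_type_right]
  refine Finset.sum_congr rfl fun C _ => ?_
  rw [Finset.mul_sum]
  refine Finset.sum_congr rfl fun a _ => ?_
  rw [Fin.prod_univ_castSucc]
  congr 1
  · refine Finset.prod_congr rfl fun i _ => hp _ _ _ fun j hj => ?_
    have hj' : j ≠ Fin.last N := fun h => by
      rw [h] at hj; exact absurd hj (not_le.2 (Fin.castSucc_lt_last i))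
    obtain ⟨j, rfl⟩ := Fin.exists_castSucc_eq.2 hj'
    simp [Fin.snocEquiv]
  · rw [Fin.update_snoc_last]
    rfl

lemma adapted_snoc {N : ℕ} (a₀ : A) {p : Fin (N + 1) → (Fin (N + 1) → A) → ℝ}
    (hp : ∀ i C C', (∀ j ≤ i, C j = C' j) → p i C = p i C') (i : Fin N) (C C' : Fin N → A)
    (h : ∀ j ≤ i, C j = C' j) :
    p i.castSucc (Fin.snoc (α := fun _ => A) C a₀) =
      p i.castSucc (Fin.snoc (α := fun _ => A) C' a₀) := by
  refine hp _ _ _ fun j hj => ?_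
  have hj' : j ≠ Fin.last N := fun h => by
    rw [h] at hj; exact absurd hj (not_le.2 (Fin.castSucc_lt_last i))
  obtain ⟨j, rfl⟩ := Fin.exists_castSucc_eq.2 hj'
  simpa using h j (by simpa using hj)

lemma sum_prod_adapted_eq_one [Nonempty A] : ∀ {N : ℕ} (p : Fin N → (Fin N → A) → ℝ)
    (_ : ∀ i C C', (∀ j ≤ i, C j = C' j) → p i C = p i C')
    (_ : ∀ i C, ∑ a, p i (Function.update C i a) = 1), ∑ C, ∏ i, p i C = 1
  | 0, p, _, _ => by simp
  | N + 1, p, hp, hb => by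
    obtain ⟨a₀⟩ := ‹Nonempty A›
    rw [sum_prod_adapted_succ a₀ p hp]
    simp only [hb, mul_one]
    refine sum_prod_adapted_eq_one (fun i C => p i.castSucc (Fin.snoc (α := fun _ => A) C a₀))
      (adapted_snoc a₀ hp) fun i C => ?_
    simp only [Fin.snoc_update]
    exact hb _ _

/-- The chain rule as an inequality: bounds on the conditional masses, uniform in the past,
multiply. -/
lemma sum_prod_adapted_le [Nonempty A] : ∀ {N : ℕ} (p : Fin N → (Fin N → A) → ℝ)
    (_ : ∀ i C C', (∀ j ≤ i, C j = C' j) → p i C = p i C') (_ : ∀ i C, 0 ≤ p i C)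
    (b : Fin N → ℝ) (_ : ∀ i C, ∑ a, p i (Function.update C i a) ≤ b i),
    ∑ C, ∏ i, p i C ≤ ∏ i, b i
  | 0, p, _, _, b, _ => by simp
  | N + 1, p, hp, h0, b, hb => by
    obtain ⟨a₀⟩ := ‹Nonempty A›
    have hb0 : 0 ≤ b (Fin.last N) :=
      (Finset.sum_nonneg fun a _ => h0 _ _).trans (hb (Fin.last N) fun _ => a₀)
    rw [sum_prod_adapted_succ a₀ p hp, Fin.prod_univ_castSucc]
    refine (Finset.sum_le_sum fun C _ => mul_le_mul_of_nonneg_left (hb _ _)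
      (Finset.prod_nonneg fun i _ => h0 _ _)).trans ?_
    rw [← Finset.sum_mul]
    refine mul_le_mul_of_nonneg_right ?_ hb0
    refine sum_prod_adapted_le (fun i C => p i.castSucc (Fin.snoc (α := fun _ => A) C a₀))
      (adapted_snoc a₀ hp) (fun i C => h0 _ _) (fun i => b i.castSucc) fun i C => ?_
    simp only [Fin.snoc_update]
    exact hb _ _

variable {M : Type*} [Fintype M] [DecidableEq M] [DecidableEq A] {N : ℕ}

lemma sum_prod_reindex (σ : M ≃ Fin N) (p : M → (M → A) → ℝ) :
    ∑ C, ∏ v, p v C = ∑ C : Fin N → A, ∏ i, p (σ.symm i) (C ∘ σ) := by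
  rw [← (σ.arrowCongr (Equiv.refl A)).symm.sum_comp]
  refine Finset.sum_congr rfl fun C _ => ?_
  rw [← σ.symm.prod_comp]
  rfl

lemma update_comp_equiv (σ : M ≃ Fin N) (C : Fin N → A) (i : Fin N) (a : A) :
    Function.update C i a ∘ σ = Function.update (C ∘ σ) (σ.symm i) a := by
  funext v
  by_cases h : v = σ.symm i
  · subst h; simp
  · have : σ v ≠ i := fun h' => h (by simp [← h'])
    simp [Function.update_of_ne h, Function.update_of_ne this]

/-- The probability that codewords drawn one after the other, uniformly from the sets `D v C`, form
the list `C`. -/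
noncomputable def drawProb (D : M → (M → A) → Finset A) (C : M → A) : ℝ :=
  ∏ v, if C v ∈ D v C then ((D v C).card : ℝ)⁻¹ else 0

lemma drawProb_nonneg (D : M → (M → A) → Finset A) (C : M → A) : 0 ≤ drawProb D C :=
  Finset.prod_nonneg fun v _ => by split_ifs <;> positivity

variable (σ : M ≃ Fin N) {D : M → (M → A) → Finset A}
  (hD : ∀ v C C', (∀ u, σ u < σ v → C u = C' u) → D v C = D v C')

include hD in
lemma drawSet_update (v : M) (C : M → A) (a : A) : D v (Function.update C v a) = D v C :=
  hD _ _ _ fun u hu => Function.update_of_ne (fun h => by simp [h] at hu) _ _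

include hD in
lemma sum_drawProb [Nonempty A] (hne : ∀ v C, (D v C).Nonempty) : ∑ C, drawProb D C = 1 := by
  have h := sum_prod_reindex σ fun v C => if C v ∈ D v C then ((D v C).card : ℝ)⁻¹ else 0
  refine h.trans (sum_prod_adapted_eq_one _ ?_ ?_)
  · intro i C C' hC
    have : D (σ.symm i) (C ∘ σ) = D (σ.symm i) (C' ∘ σ) :=
      hD _ _ _ fun u hu => hC _ (by simpa using hu.le)
    simp only [this, Function.comp_apply, Equiv.apply_symm_apply, hC i le_rfl]
  · intro i C
    simp only [update_comp_equiv, drawSet_update σ hD, Function.update_self]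
    rw [Finset.sum_ite_mem, Finset.univ_inter, Finset.sum_const, nsmul_eq_mul, mul_inv_cancel₀]
    exact_mod_cast (Finset.card_pos.2 (hne _ _)).ne'

include hD in
/-- The joint distribution of several codewords is dominated by a multiple of the uniform one. -/
lemma sum_drawProb_eq_le [Nonempty A] {b : M → ℝ} (hne : ∀ v C, (D v C).Nonempty)
    (hb : ∀ v C, ((D v C).card : ℝ)⁻¹ ≤ b v) (S : Finset M) (c : M → A) :
    ∑ C, drawProb D C * (if ∀ v ∈ S, C v = c v then 1 else 0) ≤ ∏ v ∈ S, b v := by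
  -- The event is a product of one indicator per message, so it can be absorbed into the factors of
  -- the sequential law.
  set g : M → A → ℝ := fun v a => if v ∈ S then (if a = c v then 1 else 0) else 1 with hg
  have hprod : ∀ C : M → A, (if ∀ v ∈ S, C v = c v then (1 : ℝ) else 0) = ∏ v, g v (C v) := by
    intro C
    split_ifs with h
    · refine (Finset.prod_eq_one fun v _ => ?_).symm
      by_cases hv : v ∈ S
      · simp [hg, hv, h v hv]
      · simp [hg, hv]
    · push Not at h
      obtain ⟨v, hv, hC⟩ := h
      exact (Finset.prod_eq_zero (Finset.mem_univ v) (by simp [hg, hv, hC])).symm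
  have hg0 : ∀ v a, 0 ≤ g v a := fun v a => by simp only [hg]; split_ifs <;> norm_num
  have h := sum_prod_reindex σ
    fun v C => (if C v ∈ D v C then ((D v C).card : ℝ)⁻¹ else 0) * g v (C v)
  have hb' : ∏ v ∈ S, b v = ∏ i, (fun v => if v ∈ S then b v else 1) (σ.symm i) := by
    rw [σ.symm.prod_comp fun v => if v ∈ S then b v else 1, Finset.prod_ite_mem, Finset.univ_inter]
  simp only [hprod, drawProb, ← Finset.prod_mul_distrib]
  rw [h, hb']
  refine sum_prod_adapted_le _ ?_ ?_ _ ?_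
  · intro i C C' hC
    have : D (σ.symm i) (C ∘ σ) = D (σ.symm i) (C' ∘ σ) :=
      hD _ _ _ fun u hu => hC _ (by simpa using hu.le)
    simp only [this, Function.comp_apply, Equiv.apply_symm_apply, hC i le_rfl]
  · intro i C
    exact mul_nonneg (by split_ifs <;> positivity) (hg0 _ _)
  · intro i C
    simp only [update_comp_equiv, drawSet_update σ hD, Function.update_self]
    set v := σ.symm i
    simp only [ite_mul, zero_mul]
    rw [Finset.sum_ite_mem, Finset.univ_inter, ← Finset.mul_sum]
    -- A prescribed codeword keeps at most one term of its uniform law; a free one sums to its full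
    -- conditional mass 1.
    by_cases hv : v ∈ S
    · simp only [hg, hv, if_true]
      refine le_trans ?_ (hb v (C ∘ σ))
      refine mul_le_of_le_one_right (by positivity) ?_
      rw [Finset.sum_ite_eq']
      split_ifs <;> norm_num
    · simp only [hg, hv, if_false, Finset.sum_const, nsmul_eq_mul, mul_one]
      rw [inv_mul_cancel₀]
      exact_mod_cast (Finset.card_pos.2 (hne _ _)).ne'

end SequentialSums

/-! ### The random Gilbert-Varshamov ensemble. -/

section Ensemble

open Classical

variable {V X : Type*} [Fintype V] [Fintype X]

lemma mul_rate {k n : ℕ} (hn : n ≠ 0) (P : V → ℝ) : (n : ℝ) * rate k n P = k * entropy P := by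
  have hn' : (n : ℝ) ≠ 0 := by exact_mod_cast hn
  rw [rate]; field_simp

lemma card_typeClass_mul_exp_rate_le {k n : ℕ} (hk : k ≠ 0) (hn : n ≠ 0) {P : V → ℝ}
    (hP : P ∈ types V k) : ((typeClass k P).card : ℝ) * Real.exp (-(n * rate k n P)) ≤ 1 := by
  rw [mul_rate hn, Real.exp_neg, ← div_eq_mul_inv, div_le_one (Real.exp_pos _)]
  exact card_typeClass_le hk hP

/-- Each source type contributes at most 1, as it has at most `exp(k H(P)) = exp(n R)` messages.
This makes every union bound over messages cost only a polynomial factor. -/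
lemma sum_exp_rate_le {k n : ℕ} (hk : k ≠ 0) (hn : n ≠ 0) :
    ∑ u : Fin k → V, Real.exp (-(n * rate k n (empType u))) ≤ (types V k).card := by
  rw [← sum_types_typeClass, Finset.card_eq_sum_ones, Nat.cast_sum, Nat.cast_one]
  refine Finset.sum_le_sum fun P hP => ?_
  refine le_trans (le_of_eq ?_) (card_typeClass_mul_exp_rate_le hk hn hP)
  rw [← nsmul_eq_mul, ← Finset.sum_const]
  exact Finset.sum_congr rfl fun u hu => by rw [mem_typeClass.1 hu]

/-- The fraction `exp(-n (R_j + δ))` of violating sequences compensates for the at most `exp(n R_j)`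
messages of type `P_j`, leaving `exp(-n δ)` per source type. -/
theorem rgvCondition_miDist {m k n : ℕ} (hk : k ≠ 0) (hn : n ≠ 0) {Q : Fin m → X → ℝ}
    (hQ : ∀ c, Q c ∈ types X n) (μ : (V → ℝ) → Fin m) (δ : ℝ) :
    RgvCondition k n Q μ miDist (miThreshold k n δ) δ := by
  intro c xt _
  have hterm : ∀ P ∈ types V k,
      ∑ _x ∈ (typeClass n (Q c)).filter
        (fun x => miDist (jointType x (xt P)) ≤ miThreshold k n δ P), ((typeClass k P).card : ℝ) ≤
      ((n : ℝ) + 1) ^ (Fintype.card X ^ 2 + Fintype.card X) *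
        (typeClass n (Q c)).card * Real.exp (-(n * δ)) := by
    intro P hP
    rw [Finset.sum_const, nsmul_eq_mul]
    have h := card_typeClass_mutualInfo_ge_le hn (hQ c) (xt P) (rate k n P + δ)
    have hexp : Real.exp (-(n * (rate k n P + δ))) =
        Real.exp (-(n * rate k n P)) * Real.exp (-(n * δ)) := by
      rw [← Real.exp_add]; ring_nf
    simp only [miDist, miThreshold, neg_le_neg_iff]
    refine (mul_le_mul_of_nonneg_right h (Nat.cast_nonneg _)).trans ?_
    rw [hexp, sq]
    calc _ = (((n : ℝ) + 1) ^ (Fintype.card X * Fintype.card X + Fintype.card X) *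
          (typeClass n (Q c)).card * Real.exp (-(n * δ))) *
            ((typeClass k P).card * Real.exp (-(n * rate k n P))) := by ring
      _ ≤ _ := mul_le_of_le_one_right (by positivity) (card_typeClass_mul_exp_rate_le hk hn hP)
  refine (Finset.sum_le_sum hterm).trans (le_of_eq ?_)
  rw [Finset.sum_const, nsmul_eq_mul, zeta]
  ring

variable {m k n N : ℕ} {σ : (Fin k → V) ≃ Fin N} {Q : Fin m → X → ℝ} {μ : (V → ℝ) → Fin m} {δ : ℝ}

lemma rgvProb_eq_drawProb (d : (X × X → ℝ) → ℝ) (Δ : (V → ℝ) → ℝ) (C : Codebook V X k n) :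
    rgvProb σ Q μ d Δ C = drawProb (fun v C => drawSet σ Q μ d Δ C v) C := rfl

lemma drawSet_adapted (d : (X × X → ℝ) → ℝ) (Δ : (V → ℝ) → ℝ) (v : Fin k → V)
    (C C' : Codebook V X k n) (h : ∀ u, σ u < σ v → C u = C' u) :
    drawSet σ Q μ d Δ C v = drawSet σ Q μ d Δ C' v := by
  refine Finset.filter_congr fun x _ => ?_
  exact forall₂_congr fun u hu => by rw [h u hu]

/-- At most half of a type class violates the distance constraints. -/
lemma card_typeClass_le_two_mul_card_drawSet (hk : k ≠ 0) (hn : n ≠ 0)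
    (hQ : ∀ c, Q c ∈ types X n)
    (hσ : ∀ u v, σ u ≤ σ v → entropy (empType u) ≤ entropy (empType v))
    (hζ : zeta V X k n * Real.exp (-(n * δ)) ≤ 1 / 2) (C : Codebook V X k n) (v : Fin k → V) :
    ((typeClass n (Q (μ (empType v)))).card : ℝ) ≤
      2 * (drawSet σ Q μ miDist (miThreshold k n δ) C v).card := by
  set T := typeClass n (Q (μ (empType v))) with hT
  set D := drawSet σ Q μ miDist (miThreshold k n δ) C v with hD
  -- All messages `u` are allowed here, not only the earlier ones; `sum_exp_rate_le` can afford the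
  -- overcount.
  have hcover : T ⊆ D ∪ Finset.univ.biUnion fun u : Fin k → V =>
      T.filter fun x => rate k n (empType u) + δ ≤ mutualInfo (jointType x (C u)) := by
    intro x hx
    by_cases hxD : x ∈ D
    · exact Finset.mem_union_left _ hxD
    refine Finset.mem_union_right _ ?_
    have hnot : ¬ ∀ u, σ u < σ v → max (miThreshold k n δ (empType v))
        (miThreshold k n δ (empType u)) < miDist (jointType (C u) x) :=
      fun h => hxD (Finset.mem_filter.2 ⟨hx, h⟩)
    push Not at hnot
    obtain ⟨u, hu, hle⟩ := hnot
    rw [Finset.mem_biUnion]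
    refine ⟨u, Finset.mem_univ _, Finset.mem_filter.2 ⟨hx, ?_⟩⟩
    -- This is where the order of generation enters: the earlier message has the smaller rate, so
    -- the maximum of the thresholds is its own `Δ_u`.
    have hrate : rate k n (empType u) ≤ rate k n (empType v) :=
      mul_le_mul_of_nonneg_left (hσ u v hu.le) (by positivity)
    rw [max_eq_right (by simp only [miThreshold]; linarith), miDist, miThreshold,
      neg_le_neg_iff] at hle
    rwa [mutualInfo_jointType_swap]
  have h1 : (T.card : ℝ) ≤ D.card + ∑ u : Fin k → V,
      ((T.filter fun x => rate k n (empType u) + δ ≤ mutualInfo (jointType x (C u))).card : ℝ) := by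
    exact_mod_cast (Finset.card_le_card hcover).trans ((Finset.card_union_le _ _).trans
      (Nat.add_le_add_left Finset.card_biUnion_le _))
  have h2 : ∑ u : Fin k → V,
      ((T.filter fun x => rate k n (empType u) + δ ≤ mutualInfo (jointType x (C u))).card : ℝ) ≤
      zeta V X k n * Real.exp (-(n * δ)) * T.card := by
    calc _ ≤ ∑ u : Fin k → V, ((n : ℝ) + 1) ^ (Fintype.card X ^ 2 + Fintype.card X) *
          T.card * Real.exp (-(n * δ)) * Real.exp (-(n * rate k n (empType u))) := by
          refine Finset.sum_le_sum fun u _ => ?_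
          refine (card_typeClass_mutualInfo_ge_le hn (hQ _) (C u) _).trans (le_of_eq ?_)
          rw [mul_assoc _ (Real.exp _) (Real.exp _), ← Real.exp_add, sq, ← hT]
          ring_nf
      _ ≤ ((n : ℝ) + 1) ^ (Fintype.card X ^ 2 + Fintype.card X) *
          T.card * Real.exp (-(n * δ)) * (types V k).card := by
          rw [← Finset.mul_sum]
          exact mul_le_mul_of_nonneg_left (sum_exp_rate_le hk hn) (by positivity)
      _ = _ := by rw [zeta]; ring
  have h3 : zeta V X k n * Real.exp (-(n * δ)) * T.card ≤ 1 / 2 * T.card :=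
    mul_le_mul_of_nonneg_right hζ (Nat.cast_nonneg _)
  linarith

section

variable (hk : k ≠ 0) (hn : n ≠ 0) (hQ : ∀ c, Q c ∈ types X n)
  (hσ : ∀ u v, σ u ≤ σ v → entropy (empType u) ≤ entropy (empType v))
  (hζ : zeta V X k n * Real.exp (-(n * δ)) ≤ 1 / 2)

include hk hn hQ hσ hζ

lemma drawSet_nonempty (C : Codebook V X k n) (v : Fin k → V) :
    (drawSet σ Q μ miDist (miThreshold k n δ) C v).Nonempty := by
  rw [← Finset.card_pos]
  have h := card_typeClass_le_two_mul_card_drawSet hk hn hQ hσ hζ (μ := μ) C v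
  have hp : (0 : ℝ) < (typeClass n (Q (μ (empType v)))).card := by
    exact_mod_cast typeClass_card_pos (hQ _)
  have : (0 : ℝ) < (drawSet σ Q μ miDist (miThreshold k n δ) C v).card := by linarith
  exact_mod_cast this

lemma inv_card_drawSet_le (C : Codebook V X k n) (v : Fin k → V) :
    ((drawSet σ Q μ miDist (miThreshold k n δ) C v).card : ℝ)⁻¹ ≤
      2 / (typeClass n (Q (μ (empType v)))).card := by
  have h := card_typeClass_le_two_mul_card_drawSet hk hn hQ hσ hζ (μ := μ) C v
  have hp : (0 : ℝ) < (typeClass n (Q (μ (empType v)))).card := by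
    exact_mod_cast typeClass_card_pos (hQ _)
  have hp' : (0 : ℝ) < (drawSet σ Q μ miDist (miThreshold k n δ) C v).card := by linarith
  rw [inv_eq_one_div, div_le_div_iff₀ hp' hp]
  linarith

theorem rgvWellDefined_miDist [Nonempty X] :
    RgvWellDefined n σ Q μ miDist (miThreshold k n δ) :=
  sum_drawProb σ (drawSet_adapted _ _) fun v C => drawSet_nonempty hk hn hQ hσ hζ C v

lemma sum_rgvProb_single_le [Nonempty X] (v : Fin k → V) (x : Fin n → X) :
    ∑ C : Codebook V X k n, rgvProb σ Q μ miDist (miThreshold k n δ) C *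
      (if C v = x then 1 else 0) ≤ 2 / (typeClass n (Q (μ (empType v)))).card := by
  have h := sum_drawProb_eq_le σ (drawSet_adapted (σ := σ) (Q := Q) (μ := μ) miDist
    (miThreshold k n δ)) (fun v C => drawSet_nonempty hk hn hQ hσ hζ C v)
    (fun v C => inv_card_drawSet_le hk hn hQ hσ hζ C v) {v} fun _ => x
  simpa [rgvProb_eq_drawProb] using h

lemma sum_rgvProb_pair_le [Nonempty X] {u v : Fin k → V} (huv : u ≠ v) (x x' : Fin n → X) :
    ∑ C : Codebook V X k n, rgvProb σ Q μ miDist (miThreshold k n δ) C *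
      (if C v = x ∧ C u = x' then 1 else 0) ≤
      2 / (typeClass n (Q (μ (empType v)))).card * (2 / (typeClass n (Q (μ (empType u)))).card) := by
  have h := sum_drawProb_eq_le σ (drawSet_adapted (σ := σ) (Q := Q) (μ := μ) miDist
    (miThreshold k n δ)) (fun v C => drawSet_nonempty hk hn hQ hσ hζ C v)
    (fun v C => inv_card_drawSet_le hk hn hQ hσ hζ C v) {v, u} (Function.update (fun _ => x) u x')
  rw [Finset.prod_pair huv.symm] at h
  refine le_trans (le_of_eq (Finset.sum_congr rfl fun C _ => ?_)) h
  rw [rgvProb_eq_drawProb]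
  congr 1
  refine if_congr ?_ rfl rfl
  rw [Finset.forall_mem_insert, Function.update_of_ne huv.symm]
  refine and_congr_right fun _ => ⟨fun h w hw => ?_, fun h => ?_⟩
  · rw [Finset.mem_singleton.1 hw, Function.update_self, h]
  · rw [h u (Finset.mem_singleton_self u), Function.update_self]

end

lemma rgvProb_nonneg (d : (X × X → ℝ) → ℝ) (Δ : (V → ℝ) → ℝ) (C : Codebook V X k n) :
    0 ≤ rgvProb σ Q μ d Δ C := by
  rw [rgvProb_eq_drawProb]
  exact drawProb_nonneg _ _

lemma mem_drawSet_of_rgvProb_ne_zero {d : (X × X → ℝ) → ℝ} {Δ : (V → ℝ) → ℝ}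
    {C : Codebook V X k n} (h : rgvProb σ Q μ d Δ C ≠ 0) (v : Fin k → V) :
    C v ∈ drawSet σ Q μ d Δ C v := by
  by_contra hv
  exact h (Finset.prod_eq_zero (Finset.mem_univ v) (if_neg hv))

lemma mem_typeClass_of_rgvProb_ne_zero {d : (X × X → ℝ) → ℝ} {Δ : (V → ℝ) → ℝ}
    {C : Codebook V X k n} (h : rgvProb σ Q μ d Δ C ≠ 0) (v : Fin k → V) :
    C v ∈ typeClass n (Q (μ (empType v))) :=
  (Finset.mem_filter.1 (mem_drawSet_of_rgvProb_ne_zero h v)).1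

/-- The later of the two codewords was drawn under both thresholds, and mutual information is
symmetric; hence the threshold of `v` holds in either order. -/
lemma mutualInfo_lt_of_rgvProb_ne_zero {C : Codebook V X k n}
    (h : rgvProb σ Q μ miDist (miThreshold k n δ) C ≠ 0) {u v : Fin k → V} (huv : u ≠ v) :
    mutualInfo (jointType (C v) (C u)) < rate k n (empType v) + δ := by
  rcases lt_or_gt_of_ne (σ.injective.ne huv) with hlt | hlt
  · have := (Finset.mem_filter.1 (mem_drawSet_of_rgvProb_ne_zero h v)).2 u hlt
    have := (le_max_left _ _).trans_lt this
    rw [miThreshold, miDist, neg_lt_neg_iff] at this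
    rwa [mutualInfo_jointType_swap]
  · have := (Finset.mem_filter.1 (mem_drawSet_of_rgvProb_ne_zero h u)).2 v hlt
    have := (le_max_right _ _).trans_lt this
    rwa [miThreshold, miDist, neg_lt_neg_iff] at this

end Ensemble

/-! ### Averaging over source and ensemble, and the random-coding bound. -/

section ErrorBounds

open Classical

variable {V X Y : Type*} [Fintype V] [Fintype X] [Fintype Y]

/-- This keeps the estimates in `ℝ`: an infinite `B` is trivial because `K > 0`, and otherwise `b`
is its real value. -/
lemma ofReal_le_ofReal_mul {e K : ℝ} (hK : 0 < K) {B : ℝ≥0∞}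
    (h : ∀ b : ℝ, 0 ≤ b → B ≤ ENNReal.ofReal b → e ≤ K * b) :
    ENNReal.ofReal e ≤ ENNReal.ofReal K * B := by
  by_cases hB : B = ⊤
  · rw [hB, ENNReal.mul_top (by simpa using hK)]; exact le_top
  · rw [← ENNReal.ofReal_toReal hB, ← ENNReal.ofReal_mul hK.le]
    exact ENNReal.ofReal_le_ofReal (h _ ENNReal.toReal_nonneg (ENNReal.ofReal_toReal hB).ge)

lemma le_of_ofReal_le_expNeg {n : ℕ} {r b : ℝ} {E E' : EReal} (hb : 0 ≤ b)
    (hB : expNeg n E ≤ ENNReal.ofReal b) (hE : E ≤ E') (hr : ENNReal.ofReal r ≤ expNeg n E') :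
    r ≤ b :=
  (ENNReal.ofReal_le_ofReal_iff hb).1 ((hr.trans (expNeg_antitone n hE)).trans hB)

variable {m k n N : ℕ} {σ : (Fin k → V) ≃ Fin N} {Q : Fin m → X → ℝ} {μ : (V → ℝ) → Fin m} {δ : ℝ}

/-- The error probability given the message, averaged over the ensemble. -/
noncomputable def msgErrorProb (W : X → Y → ℝ) (σ : (Fin k → V) ≃ Fin N) (Q : Fin m → X → ℝ)
    (μ : (V → ℝ) → Fin m) (δ : ℝ) (φ : Codebook V X k n → (Fin n → Y) → (Fin k → V))
    (v : Fin k → V) : ℝ :=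
  ∑ C : Codebook V X k n, rgvProb σ Q μ miDist (miThreshold k n δ) C *
    ∑ y : Fin n → Y, if φ C y = v then 0 else ∏ i, W (C v i) (y i)

lemma rgvErrorProb_eq (PV : V → ℝ) (W : X → Y → ℝ)
    (φ : Codebook V X k n → (Fin n → Y) → (Fin k → V)) :
    rgvErrorProb PV W σ Q μ miDist (miThreshold k n δ) φ =
      ∑ v : Fin k → V, (∏ i, PV (v i)) * msgErrorProb W σ Q μ δ φ v := by
  simp only [rgvErrorProb, errorProb, msgErrorProb, Finset.mul_sum]
  rw [Finset.sum_comm]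
  refine Finset.sum_congr rfl fun v _ => Finset.sum_congr rfl fun C _ =>
    Finset.sum_congr rfl fun y _ => ?_
  ring

/-- `P` is itself feasible in the minimum, because `R / t = H(P)`. -/
lemma sourceExponent_le {k n : ℕ} (hk : k ≠ 0) (hn : n ≠ 0) {P : V → ℝ} (hP : P ∈ types V k)
    (PV : V → ℝ) : sourceExponent (rate k n P / ((k : ℝ) / n)) PV ≤ relEntropy P PV := by
  refine iInf₂_le P ⟨types_subset_stdSimplex hk hP, le_of_eq ?_⟩
  have hk' : (k : ℝ) ≠ 0 := by exact_mod_cast hk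
  have hn' : (n : ℝ) ≠ 0 := by exact_mod_cast hn
  rw [rate]
  field_simp

/-- Averaging over the source: each source type contributes its own exponent. -/
lemma rgvErrorProb_le (hk : k ≠ 0) (hn : n ≠ 0) {PV : V → ℝ} (hPV : ∀ a, 0 ≤ PV a) {W : X → Y → ℝ}
    {φ : Codebook V X k n → (Fin n → Y) → (Fin k → V)} {K : ℝ} {F : (V → ℝ) → EReal}
    (h : ∀ v, ENNReal.ofReal (msgErrorProb W σ Q μ δ φ v) ≤
      ENNReal.ofReal K * expNeg n (F (empType v))) :
    ENNReal.ofReal (rgvErrorProb PV W σ Q μ miDist (miThreshold k n δ) φ) ≤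
      ENNReal.ofReal K * ∑ P ∈ types V k, expNeg n
        ((((k : ℝ) / n : ℝ) : EReal) * sourceExponent (rate k n P / ((k : ℝ) / n)) PV + F P) := by
  have hpos : ∀ v : Fin k → V, 0 ≤ ∏ i, PV (v i) := fun v => Finset.prod_nonneg fun i _ => hPV _
  rw [rgvErrorProb_eq]
  refine (Finset.le_sum_of_subadditive ENNReal.ofReal ENNReal.ofReal_zero.le
    (fun _ _ => ENNReal.ofReal_add_le) _ _).trans ?_
  rw [← sum_types_typeClass, Finset.mul_sum]
  refine Finset.sum_le_sum fun P hP => ?_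
  calc ∑ v ∈ typeClass k P, ENNReal.ofReal ((∏ i, PV (v i)) * msgErrorProb W σ Q μ δ φ v)
      ≤ ∑ v ∈ typeClass k P, ENNReal.ofReal (∏ i, PV (v i)) *
          (ENNReal.ofReal K * expNeg n (F P)) := by
        refine Finset.sum_le_sum fun v hv => ?_
        rw [ENNReal.ofReal_mul (hpos v)]
        have := h v
        rw [mem_typeClass.1 hv] at this
        exact mul_le_mul_right this _
    _ = ENNReal.ofReal (∑ v ∈ typeClass k P, ∏ i, PV (v i)) *
          (ENNReal.ofReal K * expNeg n (F P)) := by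
        rw [← Finset.sum_mul, ENNReal.ofReal_sum_of_nonneg fun v _ => hpos v]
    _ ≤ expNeg n ((((k : ℝ) / n : ℝ) : EReal) * sourceExponent (rate k n P / ((k : ℝ) / n)) PV) *
          (ENNReal.ofReal K * expNeg n (F P)) := by
        refine mul_le_mul_left ?_ _
        -- The source probability decays in its own length `k`; the factor `t = k / n` expresses
        -- this at blocklength `n`.
        rw [← expNeg_rescale hn]
        exact (sum_typeClass_le hk hPV hP).trans (expNeg_antitone k (sourceExponent_le hk hn hP PV))
    _ ≤ _ := by
        rw [mul_left_comm]
        exact mul_le_mul_right (expNeg_mul_le hn _ _) _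

section Averages

lemma sum_rgvProb_eq_sum_typeClass (v : Fin k → V)
    (f : Codebook V X k n → (Fin n → X) → ℝ) :
    ∑ C : Codebook V X k n, rgvProb σ Q μ miDist (miThreshold k n δ) C * f C (C v) =
      ∑ x ∈ typeClass n (Q (μ (empType v))), ∑ C : Codebook V X k n,
        rgvProb σ Q μ miDist (miThreshold k n δ) C * (if C v = x then 1 else 0) * f C x := by
  rw [Finset.sum_comm]
  refine Finset.sum_congr rfl fun C _ => ?_
  by_cases hC : rgvProb σ Q μ miDist (miThreshold k n δ) C = 0
  · simp [hC]
  rw [Finset.sum_eq_single (C v)]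
  · simp
  · intro x _ hx
    simp [hx.symm]
  · exact fun h => absurd (mem_typeClass_of_rgvProb_ne_zero hC v) h

variable (hk : k ≠ 0) (hn : n ≠ 0) (hQ : ∀ c, Q c ∈ types X n)
  (hσ : ∀ u v, σ u ≤ σ v → entropy (empType u) ≤ entropy (empType v))
  (hζ : zeta V X k n * Real.exp (-(n * δ)) ≤ 1 / 2)

include hk hn hQ hσ hζ

/-- Averages over pairs of codewords. -/
lemma sum_rgvProb_pair_mul_le [Nonempty X] {u v : Fin k → V} (huv : u ≠ v)
    {f : (Fin n → X) → (Fin n → X) → ℝ} (hf : ∀ x x', 0 ≤ f x x') :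
    ∑ C : Codebook V X k n, rgvProb σ Q μ miDist (miThreshold k n δ) C * f (C v) (C u) ≤
      2 / (typeClass n (Q (μ (empType v)))).card * (2 / (typeClass n (Q (μ (empType u)))).card) *
        ∑ x ∈ typeClass n (Q (μ (empType v))),
          ∑ x' ∈ (typeClass n (Q (μ (empType u)))).filter
            (fun x' => mutualInfo (jointType x x') ≤ rate k n (empType v) + δ), f x x' := by
  calc _ ≤ ∑ C : Codebook V X k n, ∑ x ∈ typeClass n (Q (μ (empType v))),
          ∑ x' ∈ (typeClass n (Q (μ (empType u)))).filter
            (fun x' => mutualInfo (jointType x x') ≤ rate k n (empType v) + δ),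
          rgvProb σ Q μ miDist (miThreshold k n δ) C *
            (if C v = x ∧ C u = x' then 1 else 0) * f x x' := by
        refine Finset.sum_le_sum fun C _ => ?_
        by_cases hC : rgvProb σ Q μ miDist (miThreshold k n δ) C = 0
        · simp [hC]
        have h0 : ∀ x x', 0 ≤ rgvProb σ Q μ miDist (miThreshold k n δ) C *
            (if C v = x ∧ C u = x' then 1 else 0) * f x x' := fun x x' =>
          mul_nonneg (mul_nonneg (rgvProb_nonneg _ _ _) (by split_ifs <;> norm_num)) (hf _ _)
        refine le_trans ?_ (Finset.single_le_sum (fun x _ => Finset.sum_nonneg fun x' _ => h0 x x')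
          (mem_typeClass_of_rgvProb_ne_zero hC v))
        refine le_trans ?_ (Finset.single_le_sum (fun x' _ => h0 (C v) x')
          (Finset.mem_filter.2 ⟨mem_typeClass_of_rgvProb_ne_zero hC u,
            (mutualInfo_lt_of_rgvProb_ne_zero hC huv).le⟩))
        simp
    _ = ∑ x ∈ typeClass n (Q (μ (empType v))),
          ∑ x' ∈ (typeClass n (Q (μ (empType u)))).filter
            (fun x' => mutualInfo (jointType x x') ≤ rate k n (empType v) + δ),
          (∑ C : Codebook V X k n, rgvProb σ Q μ miDist (miThreshold k n δ) C *
            (if C v = x ∧ C u = x' then 1 else 0)) * f x x' := by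
        rw [Finset.sum_comm]
        refine Finset.sum_congr rfl fun x _ => ?_
        rw [Finset.sum_comm]
        exact Finset.sum_congr rfl fun x' _ => by rw [Finset.sum_mul]
    _ ≤ _ := by
        rw [Finset.mul_sum]
        refine Finset.sum_le_sum fun x _ => ?_
        rw [Finset.mul_sum]
        exact Finset.sum_le_sum fun x' _ => mul_le_mul_of_nonneg_right
          (sum_rgvProb_pair_le hk hn hQ hσ hζ huv x x') (hf _ _)

end Averages

section RandomCoding

/-- Contribution of a joint type to the random-coding bound. -/
lemma sum_condTypeClass_mul_exp_le (hn : n ≠ 0) {W : X → Y → ℝ} (hW : ∀ a b, 0 ≤ W a b)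
    (x : Fin n → X) (J : X × Y → ℝ) (R : ℝ) {b : ℝ} (hb : 0 ≤ b)
    (hB : expNeg n (randomCodingExponent W (empType x) R) ≤ ENNReal.ofReal b) :
    ∑ y ∈ Finset.univ.filter (fun y : Fin n → Y => jointType x y = J),
      (∏ i, W (x i) (y i)) * Real.exp (-(n * max (mutualInfo (jointType x y) - R) 0)) ≤ b := by
  rcases (Finset.univ.filter fun y : Fin n → Y => jointType x y = J).eq_empty_or_nonempty with
    he | ⟨y₀, hy₀⟩
  · rw [he]; simpa using hb
  have hy₀ : jointType x y₀ = J := (Finset.mem_filter.1 hy₀).2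
  have hmem : J ∈ {P : X × Y → ℝ | P ∈ stdSimplex ℝ (X × Y) ∧ marg₁ P = empType x} :=
    hy₀ ▸ ⟨empType_mem_stdSimplex hn _, marg₁_jointType x y₀⟩
  rw [Finset.sum_congr rfl (g := fun y => (∏ i, W (x i) (y i)) *
    Real.exp (-(n * max (mutualInfo J - R) 0))) fun y hy => by rw [(Finset.mem_filter.1 hy).2],
    ← Finset.sum_mul]
  refine le_of_ofReal_le_expNeg hb hB (iInf₂_le J hmem) ?_
  rw [ENNReal.ofReal_mul (Finset.sum_nonneg fun y _ => Finset.prod_nonneg fun i _ => hW _ _),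
    ← expNeg_coe]
  exact (mul_le_mul_left (sum_condTypeClass_le hn hW x J) _).trans (expNeg_mul_le hn _ _)

/-- The factor in front of the exponentials in the random-coding bound. -/
noncomputable def mmiFactor (V X Y : Type*) [Fintype V] [Fintype X] [Fintype Y] (k n : ℕ) : ℝ :=
  2 * (2 * ((n : ℝ) + 1) ^ (Fintype.card X * Fintype.card Y + Fintype.card X) *
    (types V k).card) * ((n : ℝ) + 1) ^ (Fintype.card X * Fintype.card Y)

variable (hk : k ≠ 0) (hn : n ≠ 0) (hQ : ∀ c, Q c ∈ types X n)
  (hσ : ∀ u v, σ u ≤ σ v → entropy (empType u) ≤ entropy (empType v))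
  (hζ : zeta V X k n * Real.exp (-(n * δ)) ≤ 1 / 2)

include hk hn hQ hσ hζ

lemma sum_rgvProb_mmi_le [Nonempty X] {φ : Codebook V X k n → (Fin n → Y) → (Fin k → V)}
    (hφ : ∀ C, IsMetricDecoder (mmiMetric k n) C (φ C)) (v : Fin k → V) (x : Fin n → X)
    (y : Fin n → Y) :
    ∑ C : Codebook V X k n, rgvProb σ Q μ miDist (miThreshold k n δ) C *
      (if C v = x then 1 else 0) * (if φ C y = v then 0 else 1) ≤
    2 / (typeClass n (Q (μ (empType v)))).card *
      (2 * ((n : ℝ) + 1) ^ (Fintype.card X * Fintype.card Y + Fintype.card X) *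
        (types V k).card) *
      Real.exp (-(n * (mutualInfo (jointType x y) - rate k n (empType v)))) := by
  set Tv := (typeClass n (Q (μ (empType v)))).card with hTv
  set s := mutualInfo (jointType x y) - rate k n (empType v) with hs
  set L := ((n : ℝ) + 1) ^ (Fintype.card X * Fintype.card Y + Fintype.card X) with hL
  -- Indicator that `x` was sent and the codeword `x'` of `u` scores at least as high as `x` at `y`.
  set f : (Fin k → V) → (Fin n → X) → (Fin n → X) → ℝ := fun u x₁ x' =>
    if x₁ = x ∧ s + rate k n (empType u) ≤ mutualInfo (jointType x' y) then 1 else 0 with hf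
  have hf0 : ∀ u x₁ x', 0 ≤ f u x₁ x' := fun u x₁ x' => by
    simp only [hf]; split_ifs <;> norm_num
  have hp0 : ∀ C : Codebook V X k n, 0 ≤ rgvProb σ Q μ miDist (miThreshold k n δ) C := fun C => rgvProb_nonneg _ _ C
  calc _ ≤ ∑ C : Codebook V X k n, rgvProb σ Q μ miDist (miThreshold k n δ) C *
          ∑ u ∈ Finset.univ.filter (fun u => u ≠ v), f u (C v) (C u) := by
        refine Finset.sum_le_sum fun C _ => ?_
        rw [mul_assoc]
        refine mul_le_mul_of_nonneg_left ?_ (hp0 C)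
        have hnn : 0 ≤ ∑ u ∈ Finset.univ.filter (fun u => u ≠ v), f u (C v) (C u) :=
          Finset.sum_nonneg fun u _ => hf0 _ _ _
        by_cases hx : C v = x
        · by_cases hd : φ C y = v
          · simpa [hd] using hnn
          · have hq := hφ C y v
            simp only [mmiMetric, EReal.coe_le_coe_iff, hx] at hq
            have h1 : f (φ C y) (C v) (C (φ C y)) = 1 :=
              if_pos ⟨hx, by rw [hs]; linarith⟩
            simp only [hx, hd, if_true, if_false, mul_one]
            rw [← h1, hx]
            exact Finset.single_le_sum (f := fun u => f u x (C u)) (fun u _ => hf0 u x (C u))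
              (Finset.mem_filter.2 ⟨Finset.mem_univ _, hd⟩)
        · simpa [hx] using hnn
    _ = ∑ u ∈ Finset.univ.filter (fun u => u ≠ v), ∑ C : Codebook V X k n,
          rgvProb σ Q μ miDist (miThreshold k n δ) C * f u (C v) (C u) := by
        simp only [Finset.mul_sum]
        rw [Finset.sum_comm]
    _ ≤ ∑ u ∈ Finset.univ.filter (fun u => u ≠ v),
          2 / (Tv : ℝ) * 2 * (L * Real.exp (-(n * s)) *
            Real.exp (-(n * rate k n (empType u)))) := by
        refine Finset.sum_le_sum fun u hu => ?_
        have huv : u ≠ v := (Finset.mem_filter.1 hu).2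
        refine (sum_rgvProb_pair_mul_le hk hn hQ hσ hζ huv (hf0 u)).trans ?_
        have hTu : (0 : ℝ) < (typeClass n (Q (μ (empType u)))).card := by
          exact_mod_cast typeClass_card_pos (hQ _)
        have hsum : ∑ x₁ ∈ typeClass n (Q (μ (empType v))),
            ∑ x' ∈ (typeClass n (Q (μ (empType u)))).filter
              (fun x' => mutualInfo (jointType x₁ x') ≤ rate k n (empType v) + δ), f u x₁ x' ≤
            L * (typeClass n (Q (μ (empType u)))).card *
              Real.exp (-(n * (s + rate k n (empType u)))) := by
          refine le_trans ?_ (card_typeClass_mutualInfo_ge_le hn (hQ (μ (empType u))) y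
            (s + rate k n (empType u)))
          -- The distance constraint on the pair is dropped: the random-coding bound does not use
          -- it.
          calc _ ≤ ∑ x₁ : Fin n → X, ∑ x' ∈ typeClass n (Q (μ (empType u))), f u x₁ x' := by
                refine (Finset.sum_le_sum fun x₁ _ => ?_).trans
                  (Finset.sum_le_sum_of_subset_of_nonneg (Finset.subset_univ _)
                    fun x₁ _ _ => Finset.sum_nonneg fun x' _ => hf0 _ _ _)
                exact Finset.sum_le_sum_of_subset_of_nonneg (Finset.filter_subset _ _)
                  fun x' _ _ => hf0 _ _ _
            _ = ∑ x' ∈ typeClass n (Q (μ (empType u))), f u x x' := by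
                refine Finset.sum_eq_single x (fun x₁ _ hx₁ => ?_) (by simp)
                exact Finset.sum_eq_zero fun x' _ => if_neg fun h => hx₁ h.1
            _ = _ := by
                simp only [hf, true_and]
                rw [Finset.sum_boole]
        refine (mul_le_mul_of_nonneg_left hsum (by positivity)).trans (le_of_eq ?_)
        have hexp : Real.exp (-(n * (s + rate k n (empType u)))) =
            Real.exp (-(n * s)) * Real.exp (-(n * rate k n (empType u))) := by
          rw [← Real.exp_add]; ring_nf
        rw [hexp, ← hTv]
        field_simp
    _ ≤ ∑ u : Fin k → V, 2 / (Tv : ℝ) * 2 * (L * Real.exp (-(n * s)) *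
            Real.exp (-(n * rate k n (empType u)))) :=
        Finset.sum_le_sum_of_subset_of_nonneg (Finset.subset_univ _) fun u _ _ => by positivity
    _ ≤ 2 / (Tv : ℝ) * 2 * (L * Real.exp (-(n * s)) * (types V k).card) := by
        rw [← Finset.mul_sum, ← Finset.mul_sum]
        have := sum_exp_rate_le (V := V) hk hn
        gcongr
    _ = _ := by ring

theorem msgErrorProb_mmi_le [Nonempty X] {W : X → Y → ℝ} (hW : ∀ a b, 0 ≤ W a b)
    {φ : Codebook V X k n → (Fin n → Y) → (Fin k → V)}
    (hφ : ∀ C, IsMetricDecoder (mmiMetric k n) C (φ C)) (v : Fin k → V) :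
    ENNReal.ofReal (msgErrorProb W σ Q μ δ φ v) ≤ ENNReal.ofReal (mmiFactor V X Y k n) *
      expNeg n (randomCodingExponent W (Q (μ (empType v))) (rate k n (empType v))) := by
  have hN : (1 : ℝ) ≤ (types V k).card := by
    exact_mod_cast Finset.card_pos.2 ⟨_, empType_mem_types v⟩
  refine ofReal_le_ofReal_mul (by rw [mmiFactor]; positivity) fun b hb hB => ?_
  set T := typeClass n (Q (μ (empType v))) with hT
  have hTpos : (0 : ℝ) < T.card := by exact_mod_cast typeClass_card_pos (hQ _)
  set R := rate k n (empType v) with hR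
  set L := 2 * ((n : ℝ) + 1) ^ (Fintype.card X * Fintype.card Y + Fintype.card X) *
    (types V k).card with hL
  have hL1 : 1 ≤ L := by
    have : (1 : ℝ) ≤ ((n : ℝ) + 1) ^ (Fintype.card X * Fintype.card Y + Fintype.card X) :=
      one_le_pow₀ (by linarith [n.cast_nonneg (α := ℝ)])
    rw [hL]
    nlinarith
  -- The union bound, replaced by the trivial bound on the decoding error when `I < R`; this
  -- produces the positive part in the exponent.
  have hm : ∀ x y, ∑ C : Codebook V X k n, rgvProb σ Q μ miDist (miThreshold k n δ) C *
      (if C v = x then 1 else 0) * (if φ C y = v then 0 else 1) ≤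
      2 / (T.card : ℝ) * L * Real.exp (-(n * max (mutualInfo (jointType x y) - R) 0)) := by
    intro x y
    rcases le_total (mutualInfo (jointType x y) - R) 0 with h | h
    · rw [max_eq_right h, mul_zero, neg_zero, Real.exp_zero, mul_one]
      refine le_trans ?_ (le_mul_of_one_le_right (by positivity) hL1)
      refine le_trans (Finset.sum_le_sum fun C _ => ?_)
        (sum_rgvProb_single_le hk hn hQ hσ hζ (μ := μ) v x)
      refine mul_le_of_le_one_right (mul_nonneg (rgvProb_nonneg _ _ _) ?_) ?_
      · split_ifs <;> norm_num
      · split_ifs <;> norm_num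
    · rw [max_eq_left h]
      exact sum_rgvProb_mmi_le hk hn hQ hσ hζ hφ v x y
  calc msgErrorProb W σ Q μ δ φ v
      = ∑ x ∈ T, ∑ y : Fin n → Y, (∏ i, W (x i) (y i)) *
          ∑ C : Codebook V X k n, rgvProb σ Q μ miDist (miThreshold k n δ) C *
            (if C v = x then 1 else 0) * (if φ C y = v then 0 else 1) := by
        rw [msgErrorProb, sum_rgvProb_eq_sum_typeClass v
          fun C x => ∑ y : Fin n → Y, if φ C y = v then 0 else ∏ i, W (x i) (y i)]
        refine Finset.sum_congr rfl fun x _ => ?_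
        simp only [Finset.mul_sum]
        rw [Finset.sum_comm]
        refine Finset.sum_congr rfl fun y _ => Finset.sum_congr rfl fun C _ => ?_
        split_ifs <;> ring
    _ ≤ ∑ x ∈ T, ∑ y : Fin n → Y, (∏ i, W (x i) (y i)) * (2 / (T.card : ℝ) * L *
          Real.exp (-(n * max (mutualInfo (jointType x y) - R) 0))) :=
        Finset.sum_le_sum fun x _ => Finset.sum_le_sum fun y _ =>
          mul_le_mul_of_nonneg_left (hm x y) (Finset.prod_nonneg fun i _ => hW _ _)
    _ = ∑ x ∈ T, 2 / (T.card : ℝ) * L * ∑ y : Fin n → Y, (∏ i, W (x i) (y i)) *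
          Real.exp (-(n * max (mutualInfo (jointType x y) - R) 0)) := by
        refine Finset.sum_congr rfl fun x _ => ?_
        rw [Finset.mul_sum]
        exact Finset.sum_congr rfl fun y _ => by ring
    _ ≤ ∑ x ∈ T, 2 / (T.card : ℝ) * L *
          (((n : ℝ) + 1) ^ (Fintype.card X * Fintype.card Y) * b) := by
        refine Finset.sum_le_sum fun x hx => mul_le_mul_of_nonneg_left ?_ (by positivity)
        rw [← Finset.sum_fiberwise_of_maps_to (t := types (X × Y) n) (g := fun y => jointType x y)
          fun y _ => jointType_mem_types x y]
        refine (Finset.sum_le_card_nsmul _ _ b fun J _ =>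
          sum_condTypeClass_mul_exp_le hn hW x J R hb (by rwa [mem_typeClass.1 hx])).trans ?_
        rw [nsmul_eq_mul]
        refine mul_le_mul_of_nonneg_right ?_ hb
        have := card_types_le (X × Y) n
        rw [Fintype.card_prod] at this
        exact_mod_cast this
    _ = mmiFactor V X Y k n * b := by
        rw [Finset.sum_const, nsmul_eq_mul, mmiFactor, ← hL]
        field_simp

end RandomCoding

end ErrorBounds

/-! ### The expurgated bound under the likelihood metric. -/

section Expurgated

open Classical

variable {V X Y : Type*} [Fintype V] [Fintype X] [Fintype Y]

lemma sum_prod_sqrt_eq {n : ℕ} (W : X → Y → ℝ) (x x' : Fin n → X) :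
    ∑ y : Fin n → Y, ∏ i, √(W (x i) (y i) * W (x' i) (y i)) =
      ∏ i, bhattCoeff W (x i) (x' i) := by
  have h := Finset.prod_univ_sum (fun _ : Fin n => (Finset.univ : Finset Y))
    fun i b => √(W (x i) b * W (x' i) b)
  rw [Fintype.piFinset_univ] at h
  exact h.symm

lemma bhattCoeff_nonneg (W : X → Y → ℝ) (a b : X) : 0 ≤ bhattCoeff W a b :=
  Finset.sum_nonneg fun _ _ => Real.sqrt_nonneg _

lemma prod_eq_exp_of_jointType {n : ℕ} (hn : n ≠ 0) {W : X → Y → ℝ} (hW : ∀ a b, 0 ≤ W a b)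
    (x : Fin n → X) (y : Fin n → Y) (h : ∀ z : X × Y, W z.1 z.2 = 0 → jointType x y z = 0) :
    ∏ i, W (x i) (y i) = Real.exp (n * ∑ z, jointType x y z * Real.log (W z.1 z.2)) :=
  prod_eq_exp hn (fun i => (x i, y i)) (fun z : X × Y => W z.1 z.2)
    fun z hz => (hW z.1 z.2).lt_of_ne fun h0 => hz (h z h0.symm)

lemma jointType_eq_zero_of_prod_ne_zero {n : ℕ} {W : X → Y → ℝ}
    {x : Fin n → X} {y : Fin n → Y} (h : ∏ i, W (x i) (y i) ≠ 0) (z : X × Y)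
    (hz : W z.1 z.2 = 0) : jointType x y z = 0 := by
  by_contra hJ
  obtain ⟨i, rfl⟩ := exists_of_empType_ne_zero hJ
  exact h (Finset.prod_eq_zero (Finset.mem_univ i) hz)

/-- The Bhattacharyya bound for a pair of messages under the likelihood metric. -/
lemma prod_le_of_likelihoodMetric_le {k n : ℕ} (hn : n ≠ 0) {W : X → Y → ℝ}
    (hW : ∀ a b, 0 ≤ W a b) {P P' : V → ℝ} {x x' : Fin n → X} {y : Fin n → Y}
    (h : likelihoodMetric W k n P (jointType x y) ≤ likelihoodMetric W k n P' (jointType x' y)) :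
    ∏ i, W (x i) (y i) ≤ (∏ i, √(W (x i) (y i) * W (x' i) (y i))) *
      Real.exp (n * rate k n P - n * rate k n P') := by
  have hsq0 : 0 ≤ ∏ i, √(W (x i) (y i) * W (x' i) (y i)) :=
    Finset.prod_nonneg fun _ _ => Real.sqrt_nonneg _
  by_cases h0 : ∏ i, W (x i) (y i) = 0
  · rw [h0]; positivity
  have hx := jointType_eq_zero_of_prod_ne_zero h0
  rw [likelihoodMetric, if_pos hx, likelihoodMetric] at h
  split_ifs at h with hx'
  · have e := prod_eq_exp_of_jointType hn hW x y hx
    have e' := prod_eq_exp_of_jointType hn hW x' y hx'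
    rw [EReal.coe_le_coe_iff] at h
    have hn0 : (0 : ℝ) < n := by positivity
    have hle := mul_le_mul_of_nonneg_left h hn0.le
    have hpos : 0 ≤ ∏ i, W (x i) (y i) := Finset.prod_nonneg fun i _ => hW _ _
    -- Squared, the claim is `W(y|x) ≤ W(y|x') exp(2n (R - R'))` multiplied by `W(y|x)`. This is why
    -- the metric subtracts `2 R_i`.
    refine le_of_sq_le_sq ?_ (by positivity)
    have hsq : (∏ i, √(W (x i) (y i) * W (x' i) (y i))) ^ 2 =
        (∏ i, W (x i) (y i)) * ∏ i, W (x' i) (y i) := by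
      rw [← Finset.prod_pow, ← Finset.prod_mul_distrib]
      exact Finset.prod_congr rfl fun i _ => Real.sq_sqrt (mul_nonneg (hW _ _) (hW _ _))
    rw [mul_pow, hsq, sq, mul_assoc]
    refine mul_le_mul_of_nonneg_left ?_ hpos
    rw [e, e', ← Real.exp_nat_mul, ← Real.exp_add]
    refine Real.exp_le_exp.2 ?_
    push_cast
    linarith
  · exact absurd (le_bot_iff.1 h) (EReal.coe_ne_bot _)

variable {m k n N : ℕ} {σ : (Fin k → V) ≃ Fin N} {Q : Fin m → X → ℝ} {μ : (V → ℝ) → Fin m} {δ : ℝ}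

/-- Contribution of a joint type to the expurgated bound. -/
lemma sum_condTypeClass_bhattCoeff_le (hn : n ≠ 0) (hQ : ∀ c, Q c ∈ types X n) (W : X → Y → ℝ)
    (x : Fin n → X) (c : Fin m) (J : X × X → ℝ) (R : ℝ) {b : ℝ} (hb : 0 ≤ b)
    (hB : expNeg n (expurgatedExponent W (empType x) (Set.range Q) (R + δ) + (δ : EReal)) ≤
      ENNReal.ofReal b) :
    ∑ x' ∈ ((typeClass n (Q c)).filter
        (fun x' => mutualInfo (jointType x x') ≤ R + δ)).filter (fun x' => jointType x x' = J),
      ∏ i, bhattCoeff W (x i) (x' i) ≤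
    ((n : ℝ) + 1) ^ Fintype.card X * (typeClass n (Q c)).card * Real.exp (-(n * R)) * b := by
  set S := ((typeClass n (Q c)).filter
    (fun x' => mutualInfo (jointType x x') ≤ R + δ)).filter (fun x' => jointType x x' = J) with hS
  rcases S.eq_empty_or_nonempty with he | ⟨x₀, hx₀⟩
  · rw [he, Finset.sum_empty]; positivity
  have hx₀' := hx₀
  simp only [hS, Finset.mem_filter, mem_typeClass] at hx₀'
  obtain ⟨⟨hx₀Q, hI⟩, hJ⟩ := hx₀'
  have hm1 : marg₁ J = empType x := hJ ▸ marg₁_jointType x x₀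
  have hm2 : marg₂ J = Q c := by rw [← hJ, marg₂_jointType, hx₀Q]
  rw [hJ] at hI
  have hmem : J ∈ {L : X × X → ℝ | L ∈ stdSimplex ℝ (X × X) ∧ marg₁ L = empType x ∧
      marg₂ L ∈ Set.range Q ∧ mutualInfo L ≤ R + δ} :=
    ⟨hJ ▸ empType_mem_stdSimplex hn _, hm1, ⟨c, hm2.symm⟩, hI⟩
  by_cases hac : ∀ z : X × X, bhattCoeff W z.1 z.2 = 0 → J z = 0
  · set D := ∑ z : X × X, J z * -Real.log (bhattCoeff W z.1 z.2) with hD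
    have hterm : ∀ x' ∈ S, ∏ i, bhattCoeff W (x i) (x' i) = Real.exp (-(n * D)) := by
      intro x' hx'
      have hJ' : jointType x x' = J := (Finset.mem_filter.1 hx').2
      rw [prod_eq_exp_of_jointType hn (bhattCoeff_nonneg W) x x' (by rwa [hJ']), hJ', hD]
      simp [Finset.sum_neg_distrib]
    have hr : Real.exp (-(n * (D + (mutualInfo J - R)))) ≤ b := by
      -- The added `δ` cancels the one in `R + δ`, so `δ` only relaxes the constraint on the mutual
      -- information.
      refine le_of_ofReal_le_expNeg hb hB (E' := ((D + (mutualInfo J - R) : ℝ) : EReal)) ?_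
        (expNeg_coe _ _).ge
      have h1 : expurgatedExponent W (empType x) (Set.range Q) (R + δ) ≤
          ((D + (mutualInfo J - (R + δ)) : ℝ) : EReal) := by
        refine (iInf₂_le J hmem).trans (le_of_eq ?_)
        rw [meanBhattDist, if_pos hac, ← EReal.coe_add]
      refine (add_le_add_left h1 _).trans (le_of_eq ?_)
      rw [← EReal.coe_add]
      congr 1
      ring
    rw [Finset.sum_congr rfl hterm, Finset.sum_const, nsmul_eq_mul]
    have hcard : (S.card : ℝ) ≤ Real.exp (n * (entropy J - entropy (marg₁ J))) := by
      refine le_trans ?_ (card_condTypeClass_le hn x J)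
      exact_mod_cast Finset.card_le_card
        fun x' hx' => Finset.mem_filter.2 ⟨Finset.mem_univ _, (Finset.mem_filter.1 hx').2⟩
    calc (S.card : ℝ) * Real.exp (-(n * D))
        ≤ Real.exp (n * (entropy J - entropy (marg₁ J))) * Real.exp (-(n * D)) :=
          mul_le_mul_of_nonneg_right hcard (Real.exp_pos _).le
      _ = Real.exp (n * entropy (Q c)) * Real.exp (-(n * R)) *
          Real.exp (-(n * (D + (mutualInfo J - R)))) := by
          rw [← Real.exp_add, ← Real.exp_add, ← Real.exp_add, mutualInfo, hm2]
          ring_nf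
      _ ≤ _ := by
          have := exp_entropy_le_card_typeClass hn (hQ c)
          gcongr
  -- `J` charges a pair at infinite Bhattacharyya distance, so all products in the sum vanish.
  · push Not at hac
    obtain ⟨z, hz, hJz⟩ := hac
    rw [Finset.sum_eq_zero]
    · positivity
    · intro x' hx'
      have hJ' : jointType x x' = J := (Finset.mem_filter.1 hx').2
      rw [← hJ'] at hJz
      by_contra h
      exact hJz (jointType_eq_zero_of_prod_ne_zero h z hz)

/-- The factor in front of the exponentials in the expurgated bound. -/
noncomputable def expurgatedFactor (V X : Type*) [Fintype V] [Fintype X] (k n : ℕ) : ℝ :=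
  4 * ((n : ℝ) + 1) ^ (Fintype.card X * Fintype.card X) * ((n : ℝ) + 1) ^ Fintype.card X *
    (types V k).card

variable (hk : k ≠ 0) (hn : n ≠ 0) (hQ : ∀ c, Q c ∈ types X n)
  (hσ : ∀ u v, σ u ≤ σ v → entropy (empType u) ≤ entropy (empType v))
  (hζ : zeta V X k n * Real.exp (-(n * δ)) ≤ 1 / 2)

include hk hn hQ hσ hζ

theorem msgErrorProb_likelihood_le [Nonempty X] {W : X → Y → ℝ} (hW : ∀ a b, 0 ≤ W a b)
    {φ : Codebook V X k n → (Fin n → Y) → (Fin k → V)}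
    (hφ : ∀ C, IsMetricDecoder (likelihoodMetric W k n) C (φ C)) (v : Fin k → V) :
    ENNReal.ofReal (msgErrorProb W σ Q μ δ φ v) ≤ ENNReal.ofReal (expurgatedFactor V X k n) *
      expNeg n (expurgatedExponent W (Q (μ (empType v))) (Set.range Q)
        (rate k n (empType v) + δ) + (δ : EReal)) := by
  have hN : (1 : ℝ) ≤ (types V k).card := by
    exact_mod_cast Finset.card_pos.2 ⟨_, empType_mem_types v⟩
  refine ofReal_le_ofReal_mul (by rw [expurgatedFactor]; positivity) fun b hb hB => ?_
  set T := typeClass n (Q (μ (empType v))) with hT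
  have hTpos : (0 : ℝ) < T.card := by exact_mod_cast typeClass_card_pos (hQ _)
  set R := rate k n (empType v) with hR
  set B : (Fin n → X) → (Fin n → X) → ℝ := fun x x' => ∏ i, bhattCoeff W (x i) (x' i) with hBdef
  have hB0 : ∀ x x', 0 ≤ B x x' := fun x x' => Finset.prod_nonneg fun i _ => bhattCoeff_nonneg _ _ _
  set e : (Fin k → V) → ℝ := fun u => Real.exp (n * R - n * rate k n (empType u)) with he
  calc msgErrorProb W σ Q μ δ φ v
      ≤ ∑ C : Codebook V X k n, rgvProb σ Q μ miDist (miThreshold k n δ) C *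
          ∑ u ∈ Finset.univ.filter (fun u => u ≠ v), B (C v) (C u) * e u := by
        refine Finset.sum_le_sum fun C _ => mul_le_mul_of_nonneg_left ?_ (rgvProb_nonneg _ _ C)
        calc _ ≤ ∑ y : Fin n → Y, ∑ u ∈ Finset.univ.filter (fun u => u ≠ v),
              (∏ i, √(W (C v i) (y i) * W (C u i) (y i))) * e u := by
              refine Finset.sum_le_sum fun y _ => ?_
              have h0 : ∀ u, 0 ≤ (∏ i, √(W (C v i) (y i) * W (C u i) (y i))) * e u := fun u =>
                mul_nonneg (Finset.prod_nonneg fun _ _ => Real.sqrt_nonneg _) (Real.exp_pos _).le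
              split_ifs with hd
              · exact Finset.sum_nonneg fun u _ => h0 u
              · exact (prod_le_of_likelihoodMetric_le hn hW (hφ C y v)).trans
                  (Finset.single_le_sum (fun u _ => h0 u)
                    (Finset.mem_filter.2 ⟨Finset.mem_univ _, hd⟩))
          _ = _ := by
              rw [Finset.sum_comm]
              refine Finset.sum_congr rfl fun u _ => ?_
              rw [← Finset.sum_mul, sum_prod_sqrt_eq]
    _ = ∑ u ∈ Finset.univ.filter (fun u => u ≠ v), (∑ C : Codebook V X k n,
          rgvProb σ Q μ miDist (miThreshold k n δ) C * B (C v) (C u)) * e u := by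
        simp only [Finset.mul_sum, Finset.sum_mul]
        rw [Finset.sum_comm]
        exact Finset.sum_congr rfl fun u _ => Finset.sum_congr rfl fun C _ => by ring
    _ ≤ ∑ u ∈ Finset.univ.filter (fun u => u ≠ v),
          4 * ((n : ℝ) + 1) ^ (Fintype.card X * Fintype.card X) * ((n : ℝ) + 1) ^ Fintype.card X *
            b * Real.exp (-(n * rate k n (empType u))) := by
        refine Finset.sum_le_sum fun u hu => ?_
        have huv : u ≠ v := (Finset.mem_filter.1 hu).2
        set Tu := typeClass n (Q (μ (empType u))) with hTu
        have hTupos : (0 : ℝ) < Tu.card := by exact_mod_cast typeClass_card_pos (hQ _)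
        have hinner : ∀ x ∈ T,
            ∑ x' ∈ Tu.filter (fun x' => mutualInfo (jointType x x') ≤ R + δ), B x x' ≤
            ((n : ℝ) + 1) ^ (Fintype.card X * Fintype.card X) *
              (((n : ℝ) + 1) ^ Fintype.card X * Tu.card * Real.exp (-(n * R)) * b) := by
          intro x hx
          rw [← Finset.sum_fiberwise_of_maps_to (t := types (X × X) n) (g := fun x' => jointType x x')
            fun x' _ => jointType_mem_types x x']
          refine (Finset.sum_le_card_nsmul _ _ _ fun J _ =>
            sum_condTypeClass_bhattCoeff_le hn hQ W x _ J R hb (by rwa [mem_typeClass.1 hx])).trans ?_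
          rw [nsmul_eq_mul]
          refine mul_le_mul_of_nonneg_right ?_ (by positivity)
          have := card_types_le (X × X) n
          rw [Fintype.card_prod] at this
          exact_mod_cast this
        have hpair := (sum_rgvProb_pair_mul_le hk hn hQ hσ hζ (μ := μ) huv hB0).trans
          (mul_le_mul_of_nonneg_left (Finset.sum_le_card_nsmul _ _ _ hinner) (by positivity))
        refine (mul_le_mul_of_nonneg_right hpair (Real.exp_pos _).le).trans (le_of_eq ?_)
        have hexp : Real.exp (n * R - n * rate k n (empType u)) = Real.exp (n * R) * Real.exp (-(n * rate k n (empType u))) := by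
          rw [← Real.exp_add, sub_eq_add_neg]
        -- The `exp(n R)` from the metric cancels the `exp(-n R)` of the joint-type estimate; only
        -- the summable `exp(-n R_u)` remains.
        have hexp' : Real.exp (-(n * R)) * Real.exp (n * R) = 1 := by
          rw [← Real.exp_add]; simp
        rw [nsmul_eq_mul, hexp, ← hT, ← hTu]
        calc _ = 4 * ((n : ℝ) + 1) ^ (Fintype.card X * Fintype.card X) *
              ((n : ℝ) + 1) ^ Fintype.card X * b * Real.exp (-(n * rate k n (empType u))) *
              (T.card / T.card) * (Tu.card / Tu.card) *
              (Real.exp (-(n * R)) * Real.exp (n * R)) := by ring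
          _ = _ := by rw [hexp', div_self hTpos.ne', div_self hTupos.ne']; ring
    _ ≤ ∑ u : Fin k → V,
          4 * ((n : ℝ) + 1) ^ (Fintype.card X * Fintype.card X) * ((n : ℝ) + 1) ^ Fintype.card X *
            b * Real.exp (-(n * rate k n (empType u))) :=
        Finset.sum_le_sum_of_subset_of_nonneg (Finset.subset_univ _) fun u _ _ => by positivity
    _ ≤ 4 * ((n : ℝ) + 1) ^ (Fintype.card X * Fintype.card X) * ((n : ℝ) + 1) ^ Fintype.card X *
            b * (types V k).card := by
        rw [← Finset.mul_sum]
        exact mul_le_mul_of_nonneg_left (sum_exp_rate_le hk hn) (by positivity)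
    _ = _ := by rw [expurgatedFactor]; ring

end Expurgated

/-! ### Continuity of the expurgated exponent in the rate. -/

section ExpurgatedContinuity

variable {X Y : Type*} [Fintype X] [Fintype Y]

/-- The mean Bhattacharyya distance, where it is finite. -/
noncomputable def bhattSum (W : X → Y → ℝ) (L : X × X → ℝ) : ℝ :=
  ∑ z, L z * -Real.log (bhattCoeff W z.1 z.2)

/-- The joint distributions with marginals `Q` and in `𝒬` at finite mean Bhattacharyya distance. -/
def finiteCouplings (W : X → Y → ℝ) (Q : X → ℝ) (𝒬 : Set (X → ℝ)) : Set (X × X → ℝ) :=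
  {L | L ∈ stdSimplex ℝ (X × X) ∧ marg₁ L = Q ∧ marg₂ L ∈ 𝒬 ∧
    ∀ z, bhattCoeff W z.1 z.2 = 0 → L z = 0}

lemma expurgatedExponent_le {W : X → Y → ℝ} {Q : X → ℝ} {𝒬 : Set (X → ℝ)} {R : ℝ}
    {L : X × X → ℝ} (hL : L ∈ finiteCouplings W Q 𝒬) (hR : mutualInfo L ≤ R) :
    expurgatedExponent W Q 𝒬 R ≤ ((bhattSum W L + (mutualInfo L - R) : ℝ) : EReal) := by
  refine (iInf₂_le L ⟨hL.1, hL.2.1, hL.2.2.1, hR⟩).trans (le_of_eq ?_)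
  rw [meanBhattDist, if_pos hL.2.2.2, ← EReal.coe_add, bhattSum]

lemma le_expurgatedExponent {W : X → Y → ℝ} {Q : X → ℝ} {𝒬 : Set (X → ℝ)} {R : ℝ} {a : EReal}
    (h : ∀ L ∈ finiteCouplings W Q 𝒬, mutualInfo L ≤ R →
      a ≤ ((bhattSum W L + (mutualInfo L - R) : ℝ) : EReal)) :
    a ≤ expurgatedExponent W Q 𝒬 R := by
  refine le_iInf₂ fun L hL => ?_
  rw [meanBhattDist]
  split_ifs with hs
  · rw [← EReal.coe_add]
    exact h L ⟨hL.1, hL.2.1, hL.2.2.1, hs⟩ hL.2.2.2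
  · rw [EReal.top_add_coe]; exact le_top

/-- A larger rate enlarges the feasible set and lowers the objective. -/
lemma expurgatedExponent_antitone (W : X → Y → ℝ) (Q : X → ℝ) (𝒬 : Set (X → ℝ)) :
    Antitone (expurgatedExponent W Q 𝒬) := by
  intro R R' hR
  refine le_expurgatedExponent fun L hL hI => (expurgatedExponent_le hL (hI.trans hR)).trans ?_
  exact EReal.coe_le_coe (by linarith)

lemma continuous_entropy {α : Type*} [Fintype α] : Continuous (entropy : (α → ℝ) → ℝ) :=
  continuous_finsetSum _ fun a _ => Real.continuous_negMulLog.comp (continuous_apply a)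

lemma continuous_marg₁ {α β : Type*} [Fintype β] : Continuous (marg₁ : (α × β → ℝ) → α → ℝ) :=
  continuous_pi fun _ => continuous_finsetSum _ fun _ _ => continuous_apply _

lemma continuous_marg₂ {α β : Type*} [Fintype α] : Continuous (marg₂ : (α × β → ℝ) → β → ℝ) :=
  continuous_pi fun _ => continuous_finsetSum _ fun _ _ => continuous_apply _

lemma continuous_mutualInfo {α β : Type*} [Fintype α] [Fintype β] :
    Continuous (mutualInfo : (α × β → ℝ) → ℝ) :=
  ((continuous_entropy.comp continuous_marg₁).add
    (continuous_entropy.comp continuous_marg₂)).sub continuous_entropy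

lemma continuous_bhattSum (W : X → Y → ℝ) : Continuous (bhattSum W) :=
  continuous_finsetSum _ fun z _ => (continuous_apply z).mul continuous_const

lemma isCompact_finiteCouplings (W : X → Y → ℝ) (Q : X → ℝ) {𝒬 : Set (X → ℝ)} (h𝒬 : IsClosed 𝒬) :
    IsCompact (finiteCouplings W Q 𝒬) := by
  refine (isCompact_stdSimplex ℝ (X × X)).of_isClosed_subset ?_ fun L hL => hL.1
  refine (isClosed_stdSimplex ℝ (X × X)).inter
    ((isClosed_singleton.preimage continuous_marg₁).inter
      ((h𝒬.preimage continuous_marg₂).inter ?_))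
  have : {L : X × X → ℝ | ∀ z, bhattCoeff W z.1 z.2 = 0 → L z = 0} =
      ⋂ z, ⋂ _ : bhattCoeff W z.1 z.2 = 0, {L | L z = 0} := by ext; simp
  change IsClosed {L : X × X → ℝ | ∀ z, bhattCoeff W z.1 z.2 = 0 → L z = 0}
  rw [this]
  exact isClosed_iInter fun z => isClosed_iInter fun _ =>
    isClosed_singleton.preimage (continuous_apply z)

/-- The expurgated exponent is right-continuous in the rate. -/
theorem tendsto_expurgatedExponent (W : X → Y → ℝ) (Q : X → ℝ) {𝒬 : Set (X → ℝ)}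
    (h𝒬 : IsClosed 𝒬) (R : ℝ) :
    Filter.Tendsto (fun s : ℝ => expurgatedExponent W Q 𝒬 (R + s)) (𝓝[>] 0)
      (𝓝 (expurgatedExponent W Q 𝒬 R)) := by
  refine tendsto_order.2 ⟨fun a ha => ?_, fun a ha => ?_⟩
  · obtain ⟨c, hac, hc⟩ := EReal.lt_iff_exists_real_btwn.1 ha
    -- Every coupling either violates `I ≤ R` or has objective above `c`. Compactness makes the
    -- margin a uniform `ε`, which survives a rate increase `s < ε`.
    obtain ⟨ε, hε, hmin⟩ := (isCompact_finiteCouplings W Q h𝒬).exists_forall_le'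
      (f := fun L => max (mutualInfo L - R) (bhattSum W L + (mutualInfo L - R) - c)) (a := 0)
      ((continuous_mutualInfo.sub continuous_const).max
        (((continuous_bhattSum W).add (continuous_mutualInfo.sub continuous_const)).sub
          continuous_const)).continuousOn (by
        intro L hL
        rcases le_or_gt (mutualInfo L) R with h | h
        · have := EReal.coe_lt_coe_iff.1 (hc.trans_le (expurgatedExponent_le hL h))
          exact lt_max_of_lt_right (by linarith)
        · exact lt_max_of_lt_left (by linarith))
    filter_upwards [Ioo_mem_nhdsGT hε] with s hs
    refine hac.trans_le (le_expurgatedExponent fun L hL hI => EReal.coe_le_coe ?_)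
    rcases le_max_iff.1 (hmin L hL) with h | h
    · linarith [hs.2]
    · linarith [hs.2]
  · filter_upwards [self_mem_nhdsWithin] with s hs
    exact (expurgatedExponent_antitone W Q 𝒬 (by linarith [Set.mem_Ioi.1 hs])).trans_lt ha

section Mixture

variable {α β : Type*} [Fintype α] [Fintype β]

lemma marg₁_product {P : α → ℝ} {Q : β → ℝ} (hQ : ∑ b, Q b = 1) :
    marg₁ (fun z : α × β => P z.1 * Q z.2) = P := by
  funext a
  simp [marg₁, ← Finset.mul_sum, hQ]

lemma marg₂_product {P : α → ℝ} {Q : β → ℝ} (hP : ∑ a, P a = 1) :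
    marg₂ (fun z : α × β => P z.1 * Q z.2) = Q := by
  funext b
  simp [marg₂, ← Finset.sum_mul, hP]

lemma entropy_product {P : α → ℝ} {Q : β → ℝ} (hP : P ∈ stdSimplex ℝ α)
    (hQ : Q ∈ stdSimplex ℝ β) :
    entropy (fun z : α × β => P z.1 * Q z.2) = entropy P + entropy Q := by
  have h := mutualInfo_eq_sum (product_mem_stdSimplex hP hQ).1
  rw [mutualInfo, marg₁_product hQ.2, marg₂_product hP.2, Finset.sum_eq_zero] at h
  · linarith
  · intro z _
    by_cases hz : P z.1 * Q z.2 = 0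
    · rw [hz, zero_mul]
    · rw [div_self hz, Real.log_one, mul_zero]

lemma entropy_mix_ge {P Q : α → ℝ} (hP : ∀ a, 0 ≤ P a) (hQ : ∀ a, 0 ≤ Q a) {θ : ℝ}
    (h0 : 0 ≤ θ) (h1 : θ ≤ 1) :
    (1 - θ) * entropy P + θ * entropy Q ≤ entropy fun a => (1 - θ) * P a + θ * Q a := by
  simp only [entropy, Finset.mul_sum]
  rw [← Finset.sum_add_distrib]
  refine Finset.sum_le_sum fun a _ => ?_
  exact Real.concaveOn_negMulLog.2 (hP a) (hQ a) (by linarith) h0 (by ring)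

/-- Mixing a joint distribution with the product of its marginals. -/
noncomputable def mixWithProduct (L : α × β → ℝ) (θ : ℝ) : α × β → ℝ :=
  fun z => (1 - θ) * L z + θ * (marg₁ L z.1 * marg₂ L z.2)

variable {L : α × β → ℝ} (hL : L ∈ stdSimplex ℝ (α × β)) (θ : ℝ)

include hL

lemma marg₁_mixWithProduct : marg₁ (mixWithProduct L θ) = marg₁ L := by
  funext a
  have h := congrFun (marg₁_product (P := marg₁ L) (marg₂_mem_stdSimplex hL).2) a
  simp only [marg₁, mixWithProduct] at h ⊢
  rw [Finset.sum_add_distrib, ← Finset.mul_sum, ← Finset.mul_sum, h]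
  ring

lemma marg₂_mixWithProduct : marg₂ (mixWithProduct L θ) = marg₂ L := by
  funext b
  have h := congrFun (marg₂_product (Q := marg₂ L) (marg₁_mem_stdSimplex hL).2) b
  simp only [marg₂, mixWithProduct] at h ⊢
  rw [Finset.sum_add_distrib, ← Finset.mul_sum, ← Finset.mul_sum, h]
  ring

variable {θ}

lemma mixWithProduct_mem_stdSimplex (h0 : 0 ≤ θ) (h1 : θ ≤ 1) :
    mixWithProduct L θ ∈ stdSimplex ℝ (α × β) :=
  convex_stdSimplex ℝ (α × β) hL
    (product_mem_stdSimplex (marg₁_mem_stdSimplex hL) (marg₂_mem_stdSimplex hL))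
    (sub_nonneg.2 h1) h0 (by ring)

/-- The marginals stay fixed, so concavity of entropy makes mutual information convex along the
mixture, and it vanishes at the product. -/
lemma mutualInfo_mixWithProduct_le (h0 : 0 ≤ θ) (h1 : θ ≤ 1) :
    mutualInfo (mixWithProduct L θ) ≤ (1 - θ) * mutualInfo L := by
  have h := entropy_mix_ge hL.1
    (product_mem_stdSimplex (marg₁_mem_stdSimplex hL) (marg₂_mem_stdSimplex hL)).1 h0 h1
  rw [entropy_product (marg₁_mem_stdSimplex hL) (marg₂_mem_stdSimplex hL)] at h
  rw [mutualInfo, marg₁_mixWithProduct hL, marg₂_mixWithProduct hL, mutualInfo]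
  change _ ≤ entropy (mixWithProduct L θ) at h
  linarith

end Mixture

lemma bhattSum_mixWithProduct_le (W : X → Y → ℝ) {L : X × X → ℝ} {θ κ : ℝ} (h0 : 0 ≤ θ)
    (hκ : ∀ z, |marg₁ L z.1 * marg₂ L z.2 - L z| ≤ κ) :
    bhattSum W (mixWithProduct L θ) ≤
      bhattSum W L + θ * κ * ∑ z : X × X, |Real.log (bhattCoeff W z.1 z.2)| := by
  simp only [bhattSum, mixWithProduct, Finset.mul_sum]
  rw [← Finset.sum_add_distrib]
  refine Finset.sum_le_sum fun z _ => ?_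
  have h1 : (marg₁ L z.1 * marg₂ L z.2 - L z) * -Real.log (bhattCoeff W z.1 z.2) ≤
      κ * |Real.log (bhattCoeff W z.1 z.2)| := by
    refine (le_abs_self _).trans ?_
    rw [abs_mul, abs_neg]
    exact mul_le_mul_of_nonneg_right (hκ z) (abs_nonneg _)
  nlinarith [mul_le_mul_of_nonneg_left h1 h0]

/-- A uniform form of the right-continuity of the expurgated exponent. -/
theorem eventually_expurgatedExponent_le (W : X → Y → ℝ) {ε : ℝ} (hε : 0 < ε) :
    ∀ᶠ s : ℝ in 𝓝[>] 0, ∀ (Q : X → ℝ) (𝒬 : Set (X → ℝ)) (R : ℝ), 0 ≤ R →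
      (∀ q ∈ 𝒬, ∀ x x', Q x ≠ 0 → q x' ≠ 0 → bhattCoeff W x x' ≠ 0) →
      expurgatedExponent W Q 𝒬 R ≤ expurgatedExponent W Q 𝒬 (R + s) + ((s + ε : ℝ) : EReal) := by
  set D := ∑ z : X × X, |Real.log (bhattCoeff W z.1 z.2)| with hD
  have hD0 : 0 ≤ D := Finset.sum_nonneg fun _ _ => abs_nonneg _
  have hc1 : Filter.Tendsto (fun s : ℝ => √s * D) (𝓝[>] 0) (𝓝 0) := by
    have : Continuous fun s : ℝ => √s * D := by fun_prop
    simpa using (this.tendsto 0).mono_left nhdsWithin_le_nhds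
  have hc2 : Filter.Tendsto (fun s : ℝ => 2 * √(√s + s) * D) (𝓝[>] 0) (𝓝 0) := by
    have : Continuous fun s : ℝ => 2 * √(√s + s) * D := by fun_prop
    simpa using (this.tendsto 0).mono_left nhdsWithin_le_nhds
  filter_upwards [self_mem_nhdsWithin, hc1.eventually_lt_const hε, hc2.eventually_lt_const hε] with
    s hs hs1 hs2 Q 𝒬 R hR hfin
  have hs : 0 < s := hs
  have key : expurgatedExponent W Q 𝒬 R + ((-(s + ε) : ℝ) : EReal) ≤
      expurgatedExponent W Q 𝒬 (R + s) := by
    refine le_expurgatedExponent fun L hL hI => ?_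
    have hLs := hL.1
    -- The mixture of weight `θ` must be feasible at rate `R`, while `θ * κ * D` bounds its extra
    -- Bhattacharyya cost.
    suffices h : ∃ θ κ : ℝ, 0 ≤ θ ∧ θ ≤ 1 ∧ (1 - θ) * (R + s) ≤ R ∧ θ * κ * D ≤ ε ∧
        ∀ z, |marg₁ L z.1 * marg₂ L z.2 - L z| ≤ κ by
      obtain ⟨θ, κ, h0, h1, hθ, hκD, hκ⟩ := h
      have hI0 := mutualInfo_nonneg hLs
      have hImix := mutualInfo_mixWithProduct_le hLs h0 h1
      have hmem : mixWithProduct L θ ∈ finiteCouplings W Q 𝒬 := by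
        refine ⟨mixWithProduct_mem_stdSimplex hLs h0 h1, ?_, ?_, fun z hz => ?_⟩
        · rw [marg₁_mixWithProduct hLs, hL.2.1]
        · rw [marg₂_mixWithProduct hLs]; exact hL.2.2.1
        -- The product may charge pairs that `L` does not; finiteness of the distance on the
        -- supports of the marginals keeps its cost finite.
        · have h2 : marg₁ L z.1 * marg₂ L z.2 = 0 := by
            by_contra hne
            have hne := mul_ne_zero_iff.1 hne
            rw [hL.2.1] at hne
            exact hfin _ hL.2.2.1 z.1 z.2 hne.1 hne.2 hz
          rw [mixWithProduct, hL.2.2.2 z hz, h2]; ring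
      have hle : mutualInfo (mixWithProduct L θ) ≤ R := by
        have := mul_le_mul_of_nonneg_left hI (sub_nonneg.2 h1)
        linarith
      have hb := bhattSum_mixWithProduct_le W h0 hκ
      refine (add_le_add_left (expurgatedExponent_le hmem hle) _).trans ?_
      rw [← EReal.coe_add]
      refine EReal.coe_le_coe ?_
      have : 0 ≤ θ * mutualInfo L := mul_nonneg h0 hI0
      linarith
    -- For `R ≥ √s`, the weight `s / (R + s)` suffices and is at most `√s`. For smaller `R` the
    -- weight need not be small, but `I(L) ≤ √s + s` forces `L` near its product by the Pinsker-type
    -- bound, so `θ = 1` is affordable.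
    rcases le_total (√s) R with h | h
    · have hsq : 0 < √s := Real.sqrt_pos.2 hs
      have hRs : 0 < R + s := by linarith
      refine ⟨s / (R + s), 1, by positivity, (div_le_one hRs).2 (by linarith), ?_, ?_, fun z => ?_⟩
      · have : (1 - s / (R + s)) * (R + s) = R := by field_simp; ring
        exact this.le
      · have : s / (R + s) ≤ √s := by
          rw [div_le_iff₀ hRs]
          nlinarith [Real.mul_self_sqrt hs.le]
        rw [mul_one]
        exact (mul_le_mul_of_nonneg_right this hD0).trans hs1.le
      · have hK := product_mem_stdSimplex (marg₁_mem_stdSimplex hLs) (marg₂_mem_stdSimplex hLs)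
        have a1 := hK.1 z
        have a2 := stdSimplex_le_one hK z
        have a3 := hLs.1 z
        have a4 := stdSimplex_le_one hLs z
        simp only at a1 a2
        exact abs_le.2 ⟨by linarith, by linarith⟩
    · refine ⟨1, 2 * √(√s + s), zero_le_one, le_rfl, by linarith, by linarith, fun z => ?_⟩
      refine (abs_product_sub_le hLs z).trans ?_
      have := Real.sqrt_le_sqrt (hI.trans (by linarith : R + s ≤ √s + s))
      linarith
  calc expurgatedExponent W Q 𝒬 R
      = expurgatedExponent W Q 𝒬 R + ((-(s + ε) : ℝ) : EReal) + ((s + ε : ℝ) : EReal) := by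
        rw [add_assoc, ← EReal.coe_add, neg_add_cancel, EReal.coe_zero, add_zero]
    _ ≤ _ := add_le_add_left key _

lemma expNeg_add_coe {n : ℕ} (hn : n ≠ 0) (a : EReal) (c : ℝ) :
    expNeg n (a + c) = expNeg n a * ENNReal.ofReal (Real.exp (-(n * c))) := by
  induction a with
  | bot => rw [EReal.bot_add, expNeg_bot hn, ENNReal.top_mul (by simpa using Real.exp_pos _)]
  | top => rw [EReal.top_add_coe, expNeg_top hn, zero_mul]
  | coe a =>
    rw [← EReal.coe_add, expNeg_coe, expNeg_coe, ← ENNReal.ofReal_mul (Real.exp_pos _).le,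
      ← Real.exp_add]
    ring_nf

lemma expNeg_le_mul_expNeg {n : ℕ} (hn : n ≠ 0) {a b : EReal} {ε : ℝ} (h : a ≤ b + ε) :
    expNeg n b ≤ ENNReal.ofReal (Real.exp (n * ε)) * expNeg n a := by
  refine le_trans (le_of_eq ?_) (mul_le_mul_right (expNeg_antitone n h) _)
  rw [expNeg_add_coe hn, mul_left_comm, ← ENNReal.ofReal_mul (Real.exp_pos _).le, ← Real.exp_add,
    add_neg_cancel, Real.exp_zero, ENNReal.ofReal_one, mul_one]

end ExpurgatedContinuity

/-! ### Calculus of subexponential comparison. -/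

section DotLE

lemma DotLE.trans {f g h : ℕ → ℝ≥0∞} (hfg : DotLE f g) (hgh : DotLE g h) : DotLE f h := by
  intro ε hε
  filter_upwards [hfg (ε / 2) (half_pos hε), hgh (ε / 2) (half_pos hε)] with n h1 h2
  refine (h1.trans (mul_le_mul_right h2 _)).trans (le_of_eq ?_)
  rw [← mul_assoc, ← ENNReal.ofReal_mul (Real.exp_pos _).le, ← Real.exp_add, ← mul_add, add_halves]

lemma dotLE_of_eventually_le {f g : ℕ → ℝ≥0∞} (h : ∀ᶠ n in Filter.atTop, f n ≤ g n) :
    DotLE f g := by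
  intro ε hε
  filter_upwards [h] with n hn
  refine hn.trans (le_mul_of_one_le_left zero_le ?_)
  rw [← ENNReal.ofReal_one]
  exact ENNReal.ofReal_le_ofReal (Real.one_le_exp (by positivity))

lemma eventually_poly_le_exp (c : ℝ) (a : ℕ) {ε : ℝ} (hε : 0 < ε) :
    ∀ᶠ n : ℕ in Filter.atTop, c * ((n : ℝ) + 1) ^ a ≤ Real.exp (n * ε) := by
  have h := (isLittleO_pow_exp_pos_mul_atTop a hε).tendsto_div_nhds_zero
  have h2 : Filter.Tendsto (fun n : ℕ => (n : ℝ) + 1) Filter.atTop Filter.atTop :=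
    Filter.tendsto_atTop_add_const_right _ _ tendsto_natCast_atTop_atTop
  -- The factor `exp ε` pays for the shift from `n` to `n + 1`.
  have h3 := (h.comp h2).const_mul (c * Real.exp ε)
  rw [mul_zero] at h3
  filter_upwards [h3.eventually_lt_const one_pos] with n hn
  have hexp : Real.exp (ε * ((n : ℝ) + 1)) = Real.exp (n * ε) * Real.exp ε := by
    rw [← Real.exp_add]; ring_nf
  simp only [Function.comp_apply, hexp] at hn
  rw [← mul_div_assoc, div_lt_one (by positivity)] at hn
  have : c * ((n : ℝ) + 1) ^ a * Real.exp ε < Real.exp (n * ε) * Real.exp ε := by linarith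
  exact (lt_of_mul_lt_mul_right this (Real.exp_pos _).le).le

lemma dotLE_of_poly {f g : ℕ → ℝ≥0∞} {K : ℕ → ℝ} (c : ℝ) (a : ℕ)
    (hK : ∀ n, K n ≤ c * ((n : ℝ) + 1) ^ a)
    (h : ∀ᶠ n in Filter.atTop, f n ≤ ENNReal.ofReal (K n) * g n) : DotLE f g := by
  intro ε hε
  filter_upwards [h, eventually_poly_le_exp c a hε] with n hn hp
  exact hn.trans (mul_le_mul_left (ENNReal.ofReal_le_ofReal ((hK n).trans hp)) _)

lemma dotLE_expNeg_max {p₁ p₂ : ℕ → ℝ} {E₁ E₂ : ℕ → EReal}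
    (h₁ : DotLE (fun n => ENNReal.ofReal (p₁ n)) fun n => expNeg n (E₁ n))
    (h₂ : DotLE (fun n => ENNReal.ofReal (p₂ n)) fun n => expNeg n (E₂ n)) :
    DotLE (fun n => ENNReal.ofReal (min (p₁ n) (p₂ n))) fun n => expNeg n (max (E₁ n) (E₂ n)) := by
  intro ε hε
  filter_upwards [h₁ ε hε, h₂ ε hε] with n h1 h2
  rcases le_total (E₁ n) (E₂ n) with h | h
  · rw [max_eq_right h]
    exact (ENNReal.ofReal_le_ofReal (min_le_right _ _)).trans h2
  · rw [max_eq_left h]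
    exact (ENNReal.ofReal_le_ofReal (min_le_left _ _)).trans h1

end DotLE

/-! ### Passage to the limit and choice of a codebook. -/

section Asymptotics

open Classical

variable {V X Y : Type*} [Fintype V] [Fintype X] [Fintype Y]

lemma card_types_le_of_le_mul {k n : ℕ} {T : ℝ} (hT : (k : ℝ) ≤ T * n) :
    ((types V k).card : ℝ) ≤
      (|T| + 1) ^ Fintype.card V * ((n : ℝ) + 1) ^ Fintype.card V := by
  rw [← mul_pow]
  calc ((types V k).card : ℝ) ≤ ((k : ℝ) + 1) ^ Fintype.card V := by
        exact_mod_cast card_types_le V k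
    _ ≤ _ := by
        refine pow_le_pow_left₀ (by positivity) ?_ _
        have h1 : (k : ℝ) ≤ |T| * n :=
          hT.trans (mul_le_mul_of_nonneg_right (le_abs_self T) n.cast_nonneg)
        nlinarith [abs_nonneg T, n.cast_nonneg (α := ℝ)]

/-- Bounded `t` makes the number of source types polynomial in `n`, so the smallest exponent governs
the sum. -/
lemma sum_expNeg_dotLE {k : ℕ → ℕ} {T : ℝ} (hT : ∀ n, (k n : ℝ) ≤ T * n)
    (F : ℕ → (V → ℝ) → EReal) :
    DotLE (fun n => ∑ P ∈ types V (k n), expNeg n (F n P))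
      fun n => expNeg n (⨅ P ∈ types V (k n), F n P) := by
  refine dotLE_of_poly _ _ (fun n => card_types_le_of_le_mul (V := V) (hT n))
    (Filter.Eventually.of_forall fun n => ?_)
  have h : ∀ P ∈ types V (k n), expNeg n (F n P) ≤ expNeg n (⨅ P ∈ types V (k n), F n P) :=
    fun P hP => expNeg_antitone n (iInf₂_le P hP)
  refine (Finset.sum_le_card_nsmul _ _ _ h).trans (le_of_eq ?_)
  rw [nsmul_eq_mul, ENNReal.ofReal_natCast]

lemma exists_isMetricDecoder [Nonempty V] (q : (V → ℝ) → (X × Y → ℝ) → EReal) {k n : ℕ}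
    (C : Codebook V X k n) : ∃ φ, IsMetricDecoder q C φ := by
  have h : ∀ y : Fin n → Y, ∃ u : Fin k → V, ∀ v,
      q (empType v) (jointType (C v) y) ≤ q (empType u) (jointType (C u) y) := fun y =>
    Finite.exists_max fun v : Fin k → V => q (empType v) (jointType (C v) y)
  choose φ hφ using h
  exact ⟨φ, hφ⟩

/-- Some codebook of positive probability is at least as good as the ensemble average. -/
lemma exists_codebook_errorProb_le {PV : V → ℝ} {W : X → Y → ℝ} {m k n N : ℕ}
    {σ : (Fin k → V) ≃ Fin N} {Q : Fin m → X → ℝ} {μ : (V → ℝ) → Fin m} {d : (X × X → ℝ) → ℝ}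
    {Δ : (V → ℝ) → ℝ} (hwd : RgvWellDefined n σ Q μ d Δ)
    (φ : Codebook V X k n → (Fin n → Y) → (Fin k → V)) :
    ∃ C : Codebook V X k n, 0 < rgvProb σ Q μ d Δ C ∧
      errorProb PV W C (φ C) ≤ rgvErrorProb PV W σ Q μ d Δ φ := by
  by_contra! hcon
  set e := rgvErrorProb PV W σ Q μ d Δ φ with he
  rw [RgvWellDefined] at hwd
  have hle : ∀ C : Codebook V X k n,
      rgvProb σ Q μ d Δ C * e ≤ rgvProb σ Q μ d Δ C * errorProb PV W C (φ C) := by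
    intro C
    rcases (rgvProb_nonneg (σ := σ) (Q := Q) (μ := μ) d Δ C).eq_or_lt with h | h
    · rw [← h, zero_mul, zero_mul]
    · exact mul_le_mul_of_nonneg_left (hcon C h).le h.le
  obtain ⟨C, hC⟩ : ∃ C : Codebook V X k n, 0 < rgvProb σ Q μ d Δ C := by
    by_contra! h
    exact absurd (hwd.symm.le.trans (Finset.sum_nonpos fun C _ => h C)) (by norm_num)
  have hlt := Finset.sum_lt_sum (fun C _ => hle C)
    ⟨C, Finset.mem_univ C, mul_lt_mul_of_pos_left (hcon C hC) hC⟩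
  rw [← Finset.sum_mul, hwd, one_mul, he, rgvErrorProb] at hlt
  exact lt_irrefl _ hlt

variable {PV : V → ℝ} (hPV : PV ∈ stdSimplex ℝ V) {W : X → Y → ℝ} (hW : ∀ x, W x ∈ stdSimplex ℝ Y)
  {k : ℕ → ℕ} (hk : ∀ n, 1 ≤ n → 1 ≤ k n) {T : ℝ} (hT : ∀ n, (k n : ℝ) ≤ T * n)
  {m : ℕ} {Q : ℕ → Fin m → X → ℝ} (hQ : ∀ n c, Q n c ∈ types X n) {μ : ℕ → (V → ℝ) → Fin m}
  {N : ℕ → ℕ} {σ : ∀ n, (Fin (k n) → V) ≃ Fin (N n)}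
  (hσ : ∀ n u v, σ n u ≤ σ n v → entropy (empType u) ≤ entropy (empType v)) {δ : ℕ → ℝ}
  (hζ : Filter.Tendsto (fun n : ℕ => zeta V X (k n) n * Real.exp (-(n * δ n)))
    Filter.atTop (𝓝 0))

include hζ in
lemma eventually_zeta_le : ∀ᶠ n : ℕ in Filter.atTop,
    zeta V X (k n) n * Real.exp (-(n * δ n)) ≤ 1 / 2 :=
  (hζ.eventually_lt_const (by norm_num : (0 : ℝ) < 1 / 2)).mono fun _ h => h.le

include hPV hW hk hT hQ hσ hζ in
lemma rgvErrorProb_mmi_dotLE [Nonempty X]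
    {φ : ∀ n, Codebook V X (k n) n → (Fin n → Y) → (Fin (k n) → V)}
    (hφ : ∀ n C, IsMetricDecoder (mmiMetric (k n) n) C (φ n C)) :
    DotLE
      (fun n => ENNReal.ofReal (rgvErrorProb PV W (σ n) (Q n) (μ n) miDist
        (miThreshold (k n) n (δ n)) (φ n)))
      (fun n => ∑ P ∈ types V (k n), expNeg n (jsccRandomCoding W PV (k n) n (Q n) (μ n) P)) := by
  refine dotLE_of_poly (K := fun n => mmiFactor V X Y (k n) n)
    (4 * (|T| + 1) ^ Fintype.card V)
    (Fintype.card X * Fintype.card Y + Fintype.card X + Fintype.card V +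
      Fintype.card X * Fintype.card Y) (fun n => ?_) ?_
  · have h := card_types_le_of_le_mul (V := V) (hT n)
    calc mmiFactor V X Y (k n) n
        = 4 * ((n : ℝ) + 1) ^ (Fintype.card X * Fintype.card Y + Fintype.card X) *
          ((n : ℝ) + 1) ^ (Fintype.card X * Fintype.card Y) * (types V (k n)).card := by
          rw [mmiFactor]; ring
      _ ≤ _ := mul_le_mul_of_nonneg_left h (by positivity)
      _ = _ := by rw [pow_add _ _ (Fintype.card X * Fintype.card Y), pow_add _ _ (Fintype.card V)]
                  ring
  · filter_upwards [eventually_zeta_le hζ, Filter.eventually_ge_atTop 1] with n hz hn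
    have hn0 : n ≠ 0 := by omega
    have hk0 : k n ≠ 0 := by have := hk n hn; omega
    exact rgvErrorProb_le hk0 hn0 hPV.1 fun v =>
      msgErrorProb_mmi_le hk0 hn0 (hQ n) (hσ n) hz (fun a b => (hW a).1 b) (hφ n) v

include hPV hW hk hT hQ hσ hζ in
lemma rgvErrorProb_likelihood_dotLE [Nonempty X]
    {φ : ∀ n, Codebook V X (k n) n → (Fin n → Y) → (Fin (k n) → V)}
    (hφ : ∀ n C, IsMetricDecoder (likelihoodMetric W (k n) n) C (φ n C)) :
    DotLE
      (fun n => ENNReal.ofReal (rgvErrorProb PV W (σ n) (Q n) (μ n) miDist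
        (miThreshold (k n) n (δ n)) (φ n)))
      (fun n => ∑ P ∈ types V (k n),
        expNeg n (jsccExpurgated W PV (k n) n (Q n) (μ n) (δ n) P)) := by
  refine dotLE_of_poly (K := fun n => expurgatedFactor V X (k n) n)
    (4 * (|T| + 1) ^ Fintype.card V)
    (Fintype.card X * Fintype.card X + Fintype.card X + Fintype.card V) (fun n => ?_) ?_
  · have h := card_types_le_of_le_mul (V := V) (hT n)
    rw [expurgatedFactor]
    refine (mul_le_mul_of_nonneg_left h (by positivity)).trans (le_of_eq ?_)
    ring
  · filter_upwards [eventually_zeta_le hζ, Filter.eventually_ge_atTop 1] with n hz hn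
    have hn0 : n ≠ 0 := by omega
    have hk0 : k n ≠ 0 := by have := hk n hn; omega
    exact rgvErrorProb_le hk0 hn0 hPV.1 fun v =>
      msgErrorProb_likelihood_le hk0 hn0 (hQ n) (hσ n) hz (fun a b => (hW a).1 b) (hφ n) v

include hk in
-- Pointwise right-continuity would not do, as the distributions and rates change with `n`; the
-- uniform version is applied to each source type.
lemma sum_jsccExpurgated_dotLE (hδ : ∀ n, 0 < δ n)
    (hδ0 : Filter.Tendsto δ Filter.atTop (𝓝 0))
    (hfin : ∀ n c c' x x', Q n c x ≠ 0 → Q n c' x' ≠ 0 → bhattCoeff W x x' ≠ 0) :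
    DotLE
      (fun n => ∑ P ∈ types V (k n), expNeg n (jsccExpurgated W PV (k n) n (Q n) (μ n) (δ n) P))
      (fun n => ∑ P ∈ types V (k n), expNeg n (jsccExpurgated W PV (k n) n (Q n) (μ n) 0 P)) := by
  intro ε hε
  have hδ' : Filter.Tendsto δ Filter.atTop (𝓝[>] 0) :=
    tendsto_nhdsWithin_iff.2 ⟨hδ0, Filter.Eventually.of_forall hδ⟩
  filter_upwards [hδ'.eventually (eventually_expurgatedExponent_le W hε),
    Filter.eventually_ge_atTop 1] with n hE hn
  have hn0 : n ≠ 0 := by omega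
  have hk0 : k n ≠ 0 := by have := hk n hn; omega
  rw [Finset.mul_sum]
  refine Finset.sum_le_sum fun P hP => expNeg_le_mul_expNeg hn0 ?_
  have hR : 0 ≤ rate (k n) n P :=
    mul_nonneg (by positivity) (entropy_nonneg (types_subset_stdSimplex hk0 hP))
  have h := hE (Q n (μ n P)) (Set.range (Q n)) (rate (k n) n P) hR (by
    rintro _ ⟨c, rfl⟩ x x' hx hx'
    exact hfin n _ _ x x' hx hx')
  rw [jsccExpurgated, jsccExpurgated, add_zero, EReal.coe_zero, add_zero, add_assoc]
  refine add_le_add_right (h.trans (le_of_eq ?_)) _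
  rw [EReal.coe_add, add_assoc]

end Asymptotics

end RGV

open RGV in
theorem mainTheorem3 {V X Y : Type*} [Fintype V] [Fintype X] [Fintype Y]
    (PV : V → ℝ) (hPV : PV ∈ stdSimplex ℝ V)
    (W : X → Y → ℝ) (hW : ∀ x, W x ∈ stdSimplex ℝ Y)
    -- source length `k n` at blocklength `n`, with bounded transmission rate `t = k n / n`
    (k : ℕ → ℕ) (hk : ∀ n, 1 ≤ n → 1 ≤ k n) (T : ℝ) (hT : ∀ n, (k n : ℝ) ≤ T * n)
    -- codeword distributions, which are types of length `n`, and their assignment to source types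
    (m : ℕ) (Q : ℕ → Fin m → X → ℝ) (hQ : ∀ n c, Q n c ∈ types X n)
    (μ : ℕ → (V → ℝ) → Fin m)
    -- order of generation, by non-decreasing rate of the source types
    (N : ℕ → ℕ) (σ : ∀ n, (Fin (k n) → V) ≃ Fin (N n))
    (hσ : ∀ n u v, σ n u ≤ σ n v → entropy (empType u) ≤ entropy (empType v))
    (δ : ℕ → ℝ) (hδ : ∀ n, 0 < δ n)
    (hζ : Filter.Tendsto (fun n : ℕ => zeta V X (k n) n * Real.exp (-(n * δ n)))
      Filter.atTop (𝓝 0)) :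
    -- the choice satisfies the condition, and the construction never fails
    (∀ n, 1 ≤ n →
      RgvCondition (k n) n (Q n) (μ n) miDist (miThreshold (k n) n (δ n)) (δ n)) ∧
    (∀ᶠ n in Filter.atTop,
      RgvWellDefined n (σ n) (Q n) (μ n) miDist (miThreshold (k n) n (δ n))) ∧
    -- random-coding bound with the generalized MMI metric
    (∀ φ : ∀ n, Codebook V X (k n) n → (Fin n → Y) → (Fin (k n) → V),
      (∀ n C, IsMetricDecoder (mmiMetric (k n) n) C (φ n C)) →
      DotLE
        (fun n => ENNReal.ofReal (rgvErrorProb PV W (σ n) (Q n) (μ n) miDist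
          (miThreshold (k n) n (δ n)) (φ n)))
        (fun n => ∑ P ∈ types V (k n),
          expNeg n (jsccRandomCoding W PV (k n) n (Q n) (μ n) P))) ∧
    -- expurgated bound with the likelihood metric, before the passage to `δ → 0`
    (∀ φ : ∀ n, Codebook V X (k n) n → (Fin n → Y) → (Fin (k n) → V),
      (∀ n C, IsMetricDecoder (likelihoodMetric W (k n) n) C (φ n C)) →
      DotLE
        (fun n => ENNReal.ofReal (rgvErrorProb PV W (σ n) (Q n) (μ n) miDist
          (miThreshold (k n) n (δ n)) (φ n)))
        (fun n => ∑ P ∈ types V (k n),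
          expNeg n (jsccExpurgated W PV (k n) n (Q n) (μ n) (δ n) P))) ∧
    (∀ n c (R : ℝ),
      Filter.Tendsto (fun s : ℝ => expurgatedExponent W (Q n c) (Set.range (Q n)) (R + s))
        (𝓝[>] 0) (𝓝 (expurgatedExponent W (Q n c) (Set.range (Q n)) R))) ∧
    -- the case `δ → 0`, when all pairs of letters in use are at finite Bhattacharyya distance
    (Filter.Tendsto δ Filter.atTop (𝓝 0) →
      (∀ n c c' x x', Q n c x ≠ 0 → Q n c' x' ≠ 0 → bhattCoeff W x x' ≠ 0) →
      -- expurgated bound with the likelihood metric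
      (∀ φ : ∀ n, Codebook V X (k n) n → (Fin n → Y) → (Fin (k n) → V),
        (∀ n C, IsMetricDecoder (likelihoodMetric W (k n) n) C (φ n C)) →
        DotLE
          (fun n => ENNReal.ofReal (rgvErrorProb PV W (σ n) (Q n) (μ n) miDist
            (miThreshold (k n) n (δ n)) (φ n)))
          (fun n => ∑ P ∈ types V (k n),
            expNeg n (jsccExpurgated W PV (k n) n (Q n) (μ n) 0 P))) ∧
      -- with the better of the two decoders, the ensemble attains the larger of the two exponents
      (∀ φ₁ φ₂ : ∀ n, Codebook V X (k n) n → (Fin n → Y) → (Fin (k n) → V),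
        (∀ n C, IsMetricDecoder (mmiMetric (k n) n) C (φ₁ n C)) →
        (∀ n C, IsMetricDecoder (likelihoodMetric W (k n) n) C (φ₂ n C)) →
        DotLE
          (fun n => ENNReal.ofReal (min
            (rgvErrorProb PV W (σ n) (Q n) (μ n) miDist (miThreshold (k n) n (δ n)) (φ₁ n))
            (rgvErrorProb PV W (σ n) (Q n) (μ n) miDist (miThreshold (k n) n (δ n)) (φ₂ n))))
          (fun n => expNeg n (max
            (⨅ P ∈ types V (k n), jsccRandomCoding W PV (k n) n (Q n) (μ n) P)
            (⨅ P ∈ types V (k n), jsccExpurgated W PV (k n) n (Q n) (μ n) 0 P)))) ∧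
      -- and so does a sequence of codes from the ensemble
      (∃ (C : ∀ n, Codebook V X (k n) n) (φ : ∀ n, (Fin n → Y) → (Fin (k n) → V)),
        (∀ᶠ n in Filter.atTop,
          0 < rgvProb (σ n) (Q n) (μ n) miDist (miThreshold (k n) n (δ n)) (C n)) ∧
        DotLE (fun n => ENNReal.ofReal (errorProb PV W (C n) (φ n)))
          (fun n => expNeg n (max
            (⨅ P ∈ types V (k n), jsccRandomCoding W PV (k n) n (Q n) (μ n) P)
            (⨅ P ∈ types V (k n), jsccExpurgated W PV (k n) n (Q n) (μ n) 0 P))))) := by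
  have hV : Nonempty V := by
    by_contra h
    rw [not_nonempty_iff] at h
    simpa using hPV.2
  have hX : Nonempty X := by
    -- Blocklength 1 provides a sequence with a letter in it; the value of `μ` only serves as an
    -- index in `Fin m`.
    obtain ⟨x, _⟩ := mem_types.1 (hQ 1 (μ 1 0))
    exact ⟨x 0⟩
  have hwd : ∀ᶠ n in Filter.atTop,
      RgvWellDefined n (σ n) (Q n) (μ n) miDist (miThreshold (k n) n (δ n)) := by
    filter_upwards [eventually_zeta_le hζ, Filter.eventually_ge_atTop 1] with n hz hn
    exact rgvWellDefined_miDist (by have := hk n hn; omega) (by omega) (hQ n) (hσ n) hz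
  refine ⟨fun n hn => rgvCondition_miDist (by have := hk n hn; omega) (by omega) (hQ n) _ _, hwd,
    fun φ hφ => rgvErrorProb_mmi_dotLE hPV hW hk hT hQ hσ hζ hφ,
    fun φ hφ => rgvErrorProb_likelihood_dotLE hPV hW hk hT hQ hσ hζ hφ,
    fun n c R => tendsto_expurgatedExponent W _ (Set.finite_range _).isClosed R,
    fun hδ0 hfin => ?_⟩
  have hex : ∀ φ : ∀ n, Codebook V X (k n) n → (Fin n → Y) → (Fin (k n) → V),
      (∀ n C, IsMetricDecoder (likelihoodMetric W (k n) n) C (φ n C)) →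
      DotLE
        (fun n => ENNReal.ofReal (rgvErrorProb PV W (σ n) (Q n) (μ n) miDist
          (miThreshold (k n) n (δ n)) (φ n)))
        (fun n => ∑ P ∈ types V (k n),
          expNeg n (jsccExpurgated W PV (k n) n (Q n) (μ n) 0 P)) := fun φ hφ =>
    (rgvErrorProb_likelihood_dotLE hPV hW hk hT hQ hσ hζ hφ).trans
      (sum_jsccExpurgated_dotLE hk hδ hδ0 hfin)
  have hmax : ∀ φ₁ φ₂ : ∀ n, Codebook V X (k n) n → (Fin n → Y) → (Fin (k n) → V),
      (∀ n C, IsMetricDecoder (mmiMetric (k n) n) C (φ₁ n C)) →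
      (∀ n C, IsMetricDecoder (likelihoodMetric W (k n) n) C (φ₂ n C)) →
      DotLE
        (fun n => ENNReal.ofReal (min
          (rgvErrorProb PV W (σ n) (Q n) (μ n) miDist (miThreshold (k n) n (δ n)) (φ₁ n))
          (rgvErrorProb PV W (σ n) (Q n) (μ n) miDist (miThreshold (k n) n (δ n)) (φ₂ n))))
        (fun n => expNeg n (max
          (⨅ P ∈ types V (k n), jsccRandomCoding W PV (k n) n (Q n) (μ n) P)
          (⨅ P ∈ types V (k n), jsccExpurgated W PV (k n) n (Q n) (μ n) 0 P))) :=
    fun φ₁ φ₂ h₁ h₂ => dotLE_expNeg_max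
      ((rgvErrorProb_mmi_dotLE hPV hW hk hT hQ hσ hζ h₁).trans (sum_expNeg_dotLE hT _))
      ((hex φ₂ h₂).trans (sum_expNeg_dotLE hT _))
  refine ⟨hex, hmax, ?_⟩
  choose φ₁ h₁ using fun (n : ℕ) (C : Codebook V X (k n) n) =>
    exists_isMetricDecoder (X := X) (Y := Y) (mmiMetric (k n) n) C
  choose φ₂ h₂ using fun (n : ℕ) (C : Codebook V X (k n) n) =>
    exists_isMetricDecoder (X := X) (Y := Y) (likelihoodMetric W (k n) n) C
  have hcode : ∀ n, ∃ (C : Codebook V X (k n) n) (φ : (Fin n → Y) → (Fin (k n) → V)),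
      RgvWellDefined n (σ n) (Q n) (μ n) miDist (miThreshold (k n) n (δ n)) →
      0 < rgvProb (σ n) (Q n) (μ n) miDist (miThreshold (k n) n (δ n)) C ∧
      errorProb PV W C φ ≤ min
        (rgvErrorProb PV W (σ n) (Q n) (μ n) miDist (miThreshold (k n) n (δ n)) (φ₁ n))
        (rgvErrorProb PV W (σ n) (Q n) (μ n) miDist (miThreshold (k n) n (δ n)) (φ₂ n)) := by
    intro n
    by_cases h : RgvWellDefined n (σ n) (Q n) (μ n) miDist (miThreshold (k n) n (δ n))
    -- The minimum of the two averages is one of them, so it suffices to pick a good codebook for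
    -- that decoder.
    · rcases min_choice
        (rgvErrorProb PV W (σ n) (Q n) (μ n) miDist (miThreshold (k n) n (δ n)) (φ₁ n))
        (rgvErrorProb PV W (σ n) (Q n) (μ n) miDist (miThreshold (k n) n (δ n)) (φ₂ n)) with e | e
      · obtain ⟨C, hC, hle⟩ := exists_codebook_errorProb_le (PV := PV) (W := W) h (φ₁ n)
        exact ⟨C, φ₁ n C, fun _ => ⟨hC, hle.trans_eq e.symm⟩⟩
      · obtain ⟨C, hC, hle⟩ := exists_codebook_errorProb_le (PV := PV) (W := W) h (φ₂ n)
        exact ⟨C, φ₂ n C, fun _ => ⟨hC, hle.trans_eq e.symm⟩⟩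
    -- Blocklengths at which the construction may fail receive an arbitrary code; only finitely many
    -- occur.
    · obtain ⟨x⟩ := hX
      exact ⟨fun _ _ => x, φ₁ n fun _ _ => x, fun h' => absurd h' h⟩
  choose C φ hCφ using hcode
  refine ⟨C, φ, hwd.mono fun n h => (hCφ n h).1, ?_⟩
  exact (dotLE_of_eventually_le (hwd.mono fun n h =>
    ENNReal.ofReal_le_ofReal (hCφ n h).2)).trans (hmax φ₁ φ₂ h₁ h₂)
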